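/- Let $\mathcal F^2$ be the Fock space of entire functions $f$ with $\|f\|^2=\frac1\pi\int_{\mathbb C}|f(z)|^2e^{-|z|^2}\,dV(z)<\infty$, and let $\mathcal C_{a,b,c}f(z)=ce^{bz}\overline{f(\overline{az+b})}$, where $a,b,c\in\mathbb C$ satisfy $|a|=1$, $\bar a b+\bar b=0$, $|c|^2e^{|b|^2}=1$; this is a conjugation (an anti-linear isometric involution) of $\mathcal F^2$. Conventions. For a conjugation $\mathcal C$, an operator $T$ is $\mathcal C$-symmetric if $\langle\mathcal Cx,Ty\rangle=\langle\mathcal CTx,y\rangle$ for all $x,y\in\mathrm{dom}(T)$, and $\mathcal C$-selfadjoint if it is densely defined and $T=\mathcal CT^*\mathcal C$. For a family $T=(T(t))_{t\ge0}$ of unbounded linear operators, let $\mathbf D(T)$ be the set of vectors $x$ that lie in $\mathrm{dom}[T(t)T(s)]$ and satisfy $T(t)T(s)x=T(t+s)x$ for all $t,s\ge0$, and for which $t\mapsto T(t)x$ is continuous on $(0,\infty)$ with $T(t)x\to x$ as $t\to0^+$. The family is an unbounded $C_0$-semigroup if $\mathbf D(T)\neq\{0\}$. For $\omega\in\mathbb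 R$ put $\Sigma_\omega(T)=\{x\in\mathbf D(T):\sup_{t\ge0}e^{-\omega t}\|T(t)x\|<\infty\}$. The generator $A$ of $T$ is given by: $x\in\mathrm{dom}(A)$ if and only if $x=\int_0^\infty e^{-\lambda t}T(t)y\,dt$ for some $\omega\in\mathbb R$, $\lambda\in\mathbb C$ with $\mathrm{Re}\,\lambda>\omega$, and $y\in\Sigma_\omega(T)$; then $Ax=\lambda x-y$. Let $E,F\in\mathbb C$ with $E\ne0$. Let $W=(W(t))_{t\ge0}$ be an unbounded $C_0$-semigroup on $\mathcal F^2$ such that every $W(t)$ is $\mathcal C_{a,b,c}$-selfadjoint and is a restriction of the maximal weighted composition operator $$f\mapsto \xi_t\cdot (f\circ\zeta_t),\qquad \zeta_t(z)=z+Et,\quad \xi_t(z)=\exp\!\big(Ft+\tfrac12aE^2t^2\big)e^{aEtz},$$ whose domain is the set of all $f\in\mathcal F^2$ with $\xi_t\cdot(f\circ\zeta_t)\in\mathcal F^2$. Write $\Sigma_\omega=\Sigma_\omega(W)$. Then: 1. The generator $Q$ of $W$ is exactly the operator with $$\mathrm{dom}(Q)=\bigcup_{\omega\in\mathbb R}\{f\in\Sigma_\omega:(F+aEz)f+Ef'\in\Sigma_\omega\},\qquad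 Qf(z)=(F+aEz)f(z)+Ef'(z).$$ 2. $Q$ is $\mathcal C_{a,b,c}$-symmetric. 3. If $\mathrm{Re}(aE^2+|E|^2)>0$, then (a) $Q$ is not $\mathcal C_{a,b,c}$-selfadjoint, and (b) the adjoint $Q^*$ is not the generator of the adjoint semigroup $(W(t)^*)_{t\ge0}$. 4. The point spectrum of $Q$ is empty: $\sigma_p(Q)=\emptyset$. -/

import Mathlib

open Set Filter Topology MeasureTheory
open scoped ENNReal ComplexConjugate

noncomputable section

/-! ### The Fock space -/

/-- The Gaussian measure `(1/π) e^{-|z|²} dV(z)` on the complex plane. -/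
def fockMeasure : Measure ℂ :=
  volume.withDensity fun z => ENNReal.ofReal (Real.pi⁻¹ * Real.exp (-‖z‖ ^ 2))

/-- `f` is an entire function that is square integrable for the Gaussian measure. -/
structure MemFock (f : ℂ → ℂ) : Prop where
  differentiable : Differentiable ℂ f
  memLp : MemLp f 2 fockMeasure

namespace MemFock

theorem zero : MemFock fun _ => 0 := ⟨differentiable_const 0, MemLp.zero⟩

theorem add {f g : ℂ → ℂ} (hf : MemFock f) (hg : MemFock g) : MemFock fun z => f z + g z :=
  ⟨hf.1.add hg.1, hf.2.add hg.2⟩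

theorem smul {f : ℂ → ℂ} (c : ℂ) (hf : MemFock f) : MemFock fun z => c * f z :=
  ⟨hf.1.const_mul c, hf.2.const_mul c⟩

theorem neg {f : ℂ → ℂ} (hf : MemFock f) : MemFock fun z => -f z :=
  ⟨hf.1.neg, hf.2.neg⟩

theorem sub {f g : ℂ → ℂ} (hf : MemFock f) (hg : MemFock g) : MemFock fun z => f z - g z :=
  ⟨hf.1.sub hg.1, hf.2.sub hg.2⟩

end MemFock

/-- The Fock space of entire, square integrable functions. -/
structure Fock where
  toFun : ℂ → ℂ
  memFock : MemFock toFun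

namespace Fock

instance : CoeFun Fock fun _ => ℂ → ℂ := ⟨toFun⟩

theorem toFun_injective : Function.Injective toFun := by
  rintro ⟨f, hf⟩ ⟨g, hg⟩ h
  cases h
  rfl

theorem ext {f g : Fock} (h : ∀ z, f z = g z) : f = g := toFun_injective (funext h)

instance : Zero Fock := ⟨⟨fun _ => 0, MemFock.zero⟩⟩
instance : Add Fock := ⟨fun f g => ⟨fun z => f z + g z, f.memFock.add g.memFock⟩⟩
instance : Neg Fock := ⟨fun f => ⟨fun z => -f z, f.memFock.neg⟩⟩
instance : Sub Fock := ⟨fun f g => ⟨fun z => f z - g z, f.memFock.sub g.memFock⟩⟩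
instance : SMul ℂ Fock := ⟨fun c f => ⟨fun z => c * f z, f.memFock.smul c⟩⟩
instance : SMul ℕ Fock := ⟨fun n f => (n : ℂ) • f⟩
instance : SMul ℤ Fock := ⟨fun n f => (n : ℂ) • f⟩

theorem zero_apply (z : ℂ) : (0 : Fock) z = 0 := rfl
theorem add_apply (f g : Fock) (z : ℂ) : (f + g) z = f z + g z := rfl
theorem neg_apply (f : Fock) (z : ℂ) : (-f) z = -f z := rfl
theorem sub_apply (f g : Fock) (z : ℂ) : (f - g) z = f z - g z := rfl
theorem smul_apply (c : ℂ) (f : Fock) (z : ℂ) : (c • f) z = c * f z := rfl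

instance : AddCommGroup Fock :=
  toFun_injective.addCommGroup toFun rfl (fun _ _ => rfl) (fun _ => rfl) (fun _ _ => rfl)
    (fun f n => by
      funext z
      change (n : ℂ) * f z = n • f z
      simp)
    (fun f n => by
      funext z
      change (n : ℂ) * f z = n • f z
      simp)

instance : Module ℂ Fock :=
  toFun_injective.module ℂ ⟨⟨toFun, rfl⟩, fun _ _ => rfl⟩ fun _ _ => rfl

theorem differentiable (f : Fock) : Differentiable ℂ f := f.memFock.differentiable

theorem memLp (f : Fock) : MemLp f 2 fockMeasure := f.memFock.memLp

end Fock

theorem measurable_fockDensity :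
    Measurable fun z : ℂ => ENNReal.ofReal (Real.pi⁻¹ * Real.exp (-‖z‖ ^ 2)) := by
  fun_prop

theorem volume_ac_fockMeasure : (volume : Measure ℂ) ≪ fockMeasure := by
  apply withDensity_absolutelyContinuous' measurable_fockDensity.aemeasurable
  refine Eventually.of_forall fun z => ?_
  simp only [ne_eq, ENNReal.ofReal_eq_zero, not_le]
  positivity

namespace Fock

/-- The inclusion of the Fock space into `L²` of the Gaussian measure. -/
def toL2 : Fock →ₗ[ℂ] Lp ℂ 2 fockMeasure where
  toFun f := f.memLp.toLp f
  map_add' f g := MemLp.toLp_add f.memLp g.memLp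
  map_smul' c f := MemLp.toLp_const_smul c f.memLp

theorem eq_of_ae_eq {f g : ℂ → ℂ} (hf : Continuous f) (hg : Continuous g)
    (h : f =ᵐ[fockMeasure] g) : f = g :=
  (Continuous.ae_eq_iff_eq volume hf hg).1 (volume_ac_fockMeasure.ae_eq h)

theorem toL2_injective : Function.Injective toL2 := by
  intro f g h
  exact toFun_injective (eq_of_ae_eq f.differentiable.continuous g.differentiable.continuous
    ((MemLp.toLp_eq_toLp_iff f.memLp g.memLp).1 h))

instance : NormedAddCommGroup Fock := NormedAddCommGroup.induced _ _ toL2 toL2_injective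

/-- The inner product `(1/π) ∫ conj (f z) g z e^{-|z|²} dV(z)`, conjugate linear in the first
entry, as is usual in Mathlib. -/
instance : InnerProductSpace ℂ Fock := InnerProductSpace.induced toL2

theorem inner_eq (f g : Fock) : inner ℂ f g = ∫ z, conj (f z) * g z ∂fockMeasure := by
  change inner ℂ (toL2 f) (toL2 g) = _
  rw [L2.inner_def]
  refine integral_congr_ae ?_
  filter_upwards [f.memLp.coeFn_toLp, g.memLp.coeFn_toLp] with z hf hg
  change inner ℂ (f.memLp.toLp f z) (g.memLp.toLp g z) = _
  rw [hf, hg]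
  simp [mul_comm]

end Fock

/-- Square integrability for the Gaussian measure, written with the weight. -/
theorem memLp_fock_iff {f : ℂ → ℂ} (hf : Continuous f) : MemLp f 2 fockMeasure ↔
    Integrable fun z => Real.pi⁻¹ * Real.exp (-‖z‖ ^ 2) * ‖f z‖ ^ 2 := by
  rw [memLp_two_iff_integrable_sq_norm hf.aestronglyMeasurable, fockMeasure,
    integrable_withDensity_iff_integrable_smul' measurable_fockDensity
      (Eventually.of_forall fun z => ENNReal.ofReal_lt_top)]
  refine integrable_congr (Eventually.of_forall fun z => ?_)
  simp only [smul_eq_mul]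
  rw [ENNReal.toReal_ofReal (by positivity)]

namespace Fock

theorem integrable_sq (f : Fock) :
    Integrable fun z => Real.pi⁻¹ * Real.exp (-‖z‖ ^ 2) * ‖f z‖ ^ 2 :=
  (memLp_fock_iff f.differentiable.continuous).1 f.memLp

theorem norm_sq_eq (f : Fock) :
    ‖f‖ ^ 2 = ∫ z, Real.pi⁻¹ * Real.exp (-‖z‖ ^ 2) * ‖f z‖ ^ 2 := by
  have h : ((‖f‖ ^ 2 : ℝ) : ℂ) =
      ((∫ z, Real.pi⁻¹ * Real.exp (-‖z‖ ^ 2) * ‖f z‖ ^ 2 : ℝ) : ℂ) := by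
    have h1 := inner_self_eq_norm_sq_to_K (𝕜 := ℂ) f
    rw [inner_eq] at h1
    rw [← integral_complex_ofReal]
    push_cast
    refine h1.symm.trans ?_
    rw [fockMeasure, integral_withDensity_eq_integral_toReal_smul measurable_fockDensity
      (Eventually.of_forall fun z => ENNReal.ofReal_lt_top)]
    congr 1
    ext z
    rw [ENNReal.toReal_ofReal (by positivity)]
    simp [Complex.conj_mul']
  exact_mod_cast h

end Fock

/-! ### Completeness of the Fock space -/

theorem circle_mean_le {h : ℂ → ℂ} (hh : Differentiable ℂ h) (z : ℂ) (r : ℝ) :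
    ENNReal.ofReal (2 * Real.pi) * ‖h z‖ₑ ≤
      ∫⁻ θ in Ioo (-Real.pi) Real.pi, ‖h (circleMap z r θ)‖ₑ := by
  have h1 : Real.circleAverage h z r = h z := DiffContOnCl.circleAverage hh.diffContOnCl
  rw [Real.circleAverage_eq_integral_add (-Real.pi),
    intervalIntegral.integral_comp_add_right (fun θ => h (circleMap z r θ)), zero_add,
    show 2 * Real.pi + -Real.pi = Real.pi by ring,
    intervalIntegral.integral_of_le (by linarith [Real.pi_pos])] at h1
  have h2 : (2 * Real.pi) • h z = ∫ θ in Ioc (-Real.pi) Real.pi, h (circleMap z r θ) := by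
    rw [← h1, smul_smul, mul_inv_cancel₀ (by positivity), one_smul]
  have h3 := enorm_integral_le_lintegral_enorm
    (μ := volume.restrict (Ioc (-Real.pi) Real.pi)) fun θ => h (circleMap z r θ)
  rw [← h2, enorm_smul, Real.enorm_of_nonneg (by positivity)] at h3
  rwa [← restrict_Ioo_eq_restrict_Ioc] at h3

theorem disc_mean_le {h : ℂ → ℂ} (hh : Differentiable ℂ h) (z : ℂ) :
    ENNReal.ofReal Real.pi * ‖h z‖ₑ ≤ ∫⁻ w in Metric.ball 0 1, ‖h (z + w)‖ₑ := by
  rw [← lintegral_indicator Metric.isOpen_ball.measurableSet,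
    ← Complex.lintegral_comp_polarCoord_symm]
  have hm : Measurable fun p : ℝ × ℝ => ENNReal.ofReal p.1 •
      (Metric.ball (0 : ℂ) 1).indicator (fun w => ‖h (z + w)‖ₑ) (Complex.polarCoord.symm p) := by
    refine (ENNReal.measurable_ofReal.comp measurable_fst).smul
      (Measurable.comp (Measurable.indicator ?_ Metric.isOpen_ball.measurableSet) ?_)
    · exact (hh.continuous.comp (continuous_const.add continuous_id)).enorm.measurable
    · have : (Complex.polarCoord.symm : ℝ × ℝ → ℂ) =
          fun p => (p.1 : ℂ) * (Real.cos p.2 + Real.sin p.2 * Complex.I) := by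
        funext p
        simp
      rw [this]
      exact Continuous.measurable (by fun_prop)
  rw [show polarCoord.target = Ioi (0 : ℝ) ×ˢ Ioo (-Real.pi) Real.pi from rfl,
    Measure.volume_eq_prod, ← Measure.prod_restrict, lintegral_prod _ hm.aemeasurable]
  have h1 : ∫⁻ r in Ioo (0 : ℝ) 1, ENNReal.ofReal (2 * r) = 1 := by
    rw [← ofReal_integral_eq_lintegral_ofReal, ← integral_Ioc_eq_integral_Ioo,
      ← intervalIntegral.integral_of_le zero_le_one]
    · rw [intervalIntegral.integral_const_mul, integral_id]
      norm_num
    · exact ((continuous_const.mul continuous_id).integrableOn_Icc (a := 0) (b := 1)).mono_set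
        Ioo_subset_Icc_self
    · filter_upwards [ae_restrict_mem measurableSet_Ioo] with r hr
      have := hr.1
      simp only [Pi.zero_apply]
      positivity
  calc ENNReal.ofReal Real.pi * ‖h z‖ₑ
      = ∫⁻ r in Ioo (0 : ℝ) 1, ENNReal.ofReal (2 * r) * (ENNReal.ofReal Real.pi * ‖h z‖ₑ) := by
        rw [lintegral_mul_const _ (by fun_prop), h1, one_mul]
    _ ≤ ∫⁻ r in Ioo (0 : ℝ) 1, ∫⁻ θ in Ioo (-Real.pi) Real.pi, ENNReal.ofReal r •
          (Metric.ball (0 : ℂ) 1).indicator (fun w => ‖h (z + w)‖ₑ)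
            (Complex.polarCoord.symm (r, θ)) := by
        refine setLIntegral_mono' measurableSet_Ioo fun r hr => ?_
        have h2 : ∀ θ, ENNReal.ofReal r • (Metric.ball (0 : ℂ) 1).indicator
            (fun w => ‖h (z + w)‖ₑ) (Complex.polarCoord.symm (r, θ)) =
            ENNReal.ofReal r * ‖h (circleMap z r θ)‖ₑ := by
          intro θ
          rw [indicator_of_mem]
          · rw [smul_eq_mul]
            congr 3
            simp [circleMap, Complex.exp_mul_I]
          · rw [mem_ball_zero_iff, Complex.norm_polarCoord_symm, abs_of_pos hr.1]
            exact hr.2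
        simp_rw [h2]
        rw [lintegral_const_mul' _ _ ENNReal.ofReal_ne_top]
        calc ENNReal.ofReal (2 * r) * (ENNReal.ofReal Real.pi * ‖h z‖ₑ)
            = ENNReal.ofReal r * (ENNReal.ofReal (2 * Real.pi) * ‖h z‖ₑ) := by
              rw [← mul_assoc, ← mul_assoc, ← ENNReal.ofReal_mul (by linarith [hr.1]),
                ← ENNReal.ofReal_mul hr.1.le]
              congr 2
              ring
          _ ≤ _ := by gcongr; exact circle_mean_le hh z r
    _ ≤ _ := lintegral_mono_set Ioo_subset_Ioi_self

/-- Point evaluations are bounded on the Fock space, locally uniformly. -/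
theorem Fock.norm_apply_le (f : Fock) (z : ℂ) :
    ‖f z‖ ≤ Real.exp ((‖z‖ + 1) ^ 2) * ‖f‖ := by
  have h1 := disc_mean_le (f.differentiable.pow 2) z
  have h2 : ∫⁻ w in Metric.ball 0 1, ‖f (z + w) ^ 2‖ₑ ≤
      ∫⁻ w, ENNReal.ofReal (Real.exp ((‖z‖ + 1) ^ 2) * Real.pi *
        (Real.pi⁻¹ * Real.exp (-‖z + w‖ ^ 2) * ‖f (z + w)‖ ^ 2)) := by
    refine (setLIntegral_mono' Metric.isOpen_ball.measurableSet fun w hw => ?_).trans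
      (setLIntegral_le_lintegral _ _)
    rw [← ofReal_norm]
    apply ENNReal.ofReal_le_ofReal
    rw [mem_ball_zero_iff] at hw
    have h3 : 1 ≤ Real.exp ((‖z‖ + 1) ^ 2) * Real.exp (-‖z + w‖ ^ 2) := by
      rw [← Real.exp_add]
      apply Real.one_le_exp
      have h4 : ‖z + w‖ ≤ ‖z‖ + 1 := (norm_add_le z w).trans (by linarith)
      nlinarith [norm_nonneg (z + w)]
    calc ‖f (z + w) ^ 2‖ = 1 * ‖f (z + w)‖ ^ 2 := by rw [norm_pow, one_mul]
      _ ≤ (Real.exp ((‖z‖ + 1) ^ 2) * Real.exp (-‖z + w‖ ^ 2)) * ‖f (z + w)‖ ^ 2 := by gcongr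
      _ = _ := by field_simp
  rw [lintegral_add_left_eq_self (fun w => ENNReal.ofReal (Real.exp ((‖z‖ + 1) ^ 2) * Real.pi *
        (Real.pi⁻¹ * Real.exp (-‖w‖ ^ 2) * ‖f w‖ ^ 2))) z,
    ← ofReal_integral_eq_lintegral_ofReal (f.integrable_sq.const_mul _)
      (Eventually.of_forall fun w => by simp only [Pi.zero_apply]; positivity),
    integral_const_mul, ← f.norm_sq_eq] at h2
  have h5 := h1.trans h2
  simp only [Pi.pow_apply] at h5
  rw [← ofReal_norm, ← ENNReal.ofReal_mul (by positivity),
    ENNReal.ofReal_le_ofReal_iff (by positivity), norm_pow] at h5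
  have h6 : ‖f z‖ ^ 2 ≤ Real.exp ((‖z‖ + 1) ^ 2) * ‖f‖ ^ 2 :=
    le_of_mul_le_mul_left (by linarith) Real.pi_pos
  refine (pow_le_pow_iff_left₀ (norm_nonneg _) (by positivity) two_ne_zero).1 (h6.trans ?_)
  rw [mul_pow]
  gcongr
  nlinarith [Real.one_le_exp (sq_nonneg (‖z‖ + 1))]

instance Fock.completeSpace : CompleteSpace Fock := by
  refine Metric.complete_of_cauchySeq_tendsto fun u hu => ?_
  have hu2 : CauchySeq fun n => toL2 (u n) := by
    rw [Metric.cauchySeq_iff] at hu ⊢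
    intro ε hε
    obtain ⟨N, hN⟩ := hu ε hε
    refine ⟨N, fun m hm n hn => ?_⟩
    have := hN m hm n hn
    rw [dist_eq_norm] at this ⊢
    rw [← map_sub]
    exact this
  obtain ⟨g, hg⟩ := cauchySeq_tendsto_of_complete hu2
  -- locally uniform Cauchy property of the functions
  have hunif : ∀ K, IsCompact K → UniformCauchySeqOn (fun n z => u n z) atTop K := by
    intro K hK
    obtain ⟨R, hR⟩ := hK.isBounded.exists_norm_le
    rw [Metric.uniformCauchySeqOn_iff]
    intro ε hε
    obtain ⟨N, hN⟩ := Metric.cauchySeq_iff.1 hu (ε / Real.exp ((|R| + 1) ^ 2)) (by positivity)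
    refine ⟨N, fun m hm n hn z hz => ?_⟩
    have h1 := hN m hm n hn
    rw [dist_eq_norm, lt_div_iff₀ (by positivity)] at h1
    rw [dist_eq_norm, ← Fock.sub_apply]
    refine ((u m - u n).norm_apply_le z).trans_lt (lt_of_le_of_lt ?_ h1)
    rw [mul_comm]
    have : ‖z‖ ≤ |R| := (hR z hz).trans (le_abs_self R)
    gcongr
  have hpt : ∀ z, ∃ y, Tendsto (fun n => u n z) atTop (𝓝 y) := fun z =>
    cauchySeq_tendsto_of_complete
      ((hunif {z} isCompact_singleton).cauchySeq (mem_singleton z))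
  choose F hF using hpt
  have hloc : TendstoLocallyUniformlyOn (fun n z => u n z) F atTop univ := by
    rw [tendstoLocallyUniformlyOn_iff_forall_isCompact isOpen_univ]
    exact fun K _ hK => (hunif K hK).tendstoUniformlyOn_of_tendsto fun z _ => hF z
  have hFd : Differentiable ℂ F := by
    rw [← differentiableOn_univ]
    exact hloc.differentiableOn
      (Eventually.of_forall fun n => (u n).differentiable.differentiableOn) isOpen_univ
  obtain ⟨ns, hns, hae⟩ :=
    (tendstoInMeasure_of_tendsto_Lp hg).exists_seq_tendsto_ae
  have hFg : F =ᵐ[fockMeasure] g := by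
    have h1 : ∀ᵐ z ∂fockMeasure, ∀ n, toL2 (u n) z = u n z :=
      ae_all_iff.2 fun n => (u n).memLp.coeFn_toLp
    filter_upwards [hae, h1] with z hz h1
    simp_rw [h1] at hz
    exact tendsto_nhds_unique ((hF z).comp hns.tendsto_atTop) hz
  have hFm : MemFock F := ⟨hFd, (memLp_congr_ae hFg).2 (Lp.memLp g)⟩
  refine ⟨⟨F, hFm⟩, ?_⟩
  have hFL : toL2 ⟨F, hFm⟩ = g := Lp.ext ((MemLp.coeFn_toLp hFm.memLp).trans hFg)
  rw [tendsto_iff_dist_tendsto_zero] at hg ⊢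
  refine hg.congr fun n => ?_
  rw [← hFL, dist_eq_norm, dist_eq_norm, ← map_sub]
  rfl

/-! ### Conjugations and complex symmetric operators -/

/-- A conjugation: an anti-linear, isometric involution. -/
structure Conjugation (H : Type*) [NormedAddCommGroup H] [InnerProductSpace ℂ H] where
  toFun : H →ₗ⋆[ℂ] H
  norm_map : ∀ x, ‖toFun x‖ = ‖x‖
  involutive : ∀ x, toFun (toFun x) = x

instance {H : Type*} [NormedAddCommGroup H] [InnerProductSpace ℂ H] :
    CoeFun (Conjugation H) fun _ => H → H := ⟨fun C => C.toFun⟩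

/-- The operator `C T C`, with domain `{x | C x ∈ dom T}`. -/
def Conjugation.sandwich {H : Type*} [NormedAddCommGroup H] [InnerProductSpace ℂ H]
    (C : Conjugation H) (T : H →ₗ.[ℂ] H) : H →ₗ.[ℂ] H where
  domain := T.domain.comap C.toFun
  toFun :=
    { toFun := fun x => C (T ⟨C x, x.2⟩)
      map_add' := fun x y => by
        rw [← map_add, ← T.map_add]
        congr 3
        exact map_add C.toFun _ _
      map_smul' := fun c x => by
        have h : (⟨C (c • x : T.domain.comap C.toFun), (c • x).2⟩ : T.domain) =
            (starRingEnd ℂ c) • ⟨C x, x.2⟩ := Subtype.ext (C.toFun.map_smulₛₗ c x)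
        rw [h, T.map_smul, C.toFun.map_smulₛₗ]
        simp }

/-- `T` is `C`-symmetric: `⟨C x, T y⟩ = ⟨C T x, y⟩` on the domain of `T`. -/
def IsCSymmetric {H : Type*} [NormedAddCommGroup H] [InnerProductSpace ℂ H]
    (C : Conjugation H) (T : H →ₗ.[ℂ] H) : Prop :=
  ∀ x y : T.domain, inner ℂ (C x) (T y) = inner ℂ (C (T x)) (y : H)

/-- `T` is `C`-selfadjoint: it is densely defined and `T = C T* C`. -/
def IsCSelfadjoint {H : Type*} [NormedAddCommGroup H] [InnerProductSpace ℂ H] [CompleteSpace H]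
    (C : Conjugation H) (T : H →ₗ.[ℂ] H) : Prop :=
  Dense (T.domain : Set H) ∧ T = C.sandwich T.adjoint

/-- The point spectrum, i.e. the set of eigenvalues, of an unbounded operator. -/
def pointSpectrum {X : Type*} [NormedAddCommGroup X] [NormedSpace ℂ X] (T : X →ₗ.[ℂ] X) : Set ℂ :=
  {η | ∃ x : T.domain, (x : X) ≠ 0 ∧ T x = η • (x : X)}

/-! ### Semigroups of unbounded operators

A family `(T(t))_{t ≥ 0}` of unbounded operators is a function on `ℝ` whose values at negative
times are never used. -/

section Semigroup

variable {X : Type*} [NormedAddCommGroup X] [NormedSpace ℂ X]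

open Classical in
/-- The orbit `t ↦ T(t) x` (with the value `0` at those `t` for which `x ∉ dom T(t)`; it is only
used for `x` in the domain of all `T(t)`, `t ≥ 0`). -/
def orbit (T : ℝ → X →ₗ.[ℂ] X) (x : X) (t : ℝ) : X :=
  if h : x ∈ (T t).domain then T t ⟨x, h⟩ else 0

/-- The vectors `x` in the domain of all the products `T(t) T(s)` with `T(t) T(s) x = T(t + s) x`,
and such that `T(·) x` is continuous on `(0, ∞)` and tends to `x` at `0`. -/
def semigroupVectors (T : ℝ → X →ₗ.[ℂ] X) : Set X :=
  {x | (∀ t s : ℝ, 0 ≤ t → 0 ≤ s →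
        ∃ (hs : x ∈ (T s).domain) (hts : T s ⟨x, hs⟩ ∈ (T t).domain) (h : x ∈ (T (t + s)).domain),
          T t ⟨T s ⟨x, hs⟩, hts⟩ = T (t + s) ⟨x, h⟩) ∧
      ContinuousOn (orbit T x) (Ioi 0) ∧ Tendsto (orbit T x) (𝓝[>] 0) (𝓝 x)}

/-- An unbounded `C₀`-semigroup. -/
def IsUnboundedC0Semigroup (T : ℝ → X →ₗ.[ℂ] X) : Prop :=
  ∃ x ∈ semigroupVectors T, x ≠ 0

/-- `N_ω(x) = sup_{t ≥ 0} e^{-ωt} ‖T(t) x‖`, possibly infinite. -/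
def growthNorm (T : ℝ → X →ₗ.[ℂ] X) (ω : ℝ) (x : X) : ℝ≥0∞ :=
  ⨆ t ∈ Ici (0 : ℝ), ENNReal.ofReal (Real.exp (-ω * t) * ‖orbit T x t‖)

/-- The set `Σ_ω`. -/
def sigmaSet (T : ℝ → X →ₗ.[ℂ] X) (ω : ℝ) : Set X :=
  {x | x ∈ semigroupVectors T ∧ growthNorm T ω x < ∞}

/-- `J_λ x = ∫_0^∞ e^{-λt} T(t) x dt`. -/
def laplaceTransform (T : ℝ → X →ₗ.[ℂ] X) (l : ℂ) (x : X) : X :=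
  ∫ t in Ioi (0 : ℝ), Complex.exp (-l * t) • orbit T x t

/-- The graph of the generator `A`: `x ∈ dom A` when `x = J_λ y` for some real `ω`, some `λ` with
`Re λ > ω` and some `y ∈ Σ_ω`, and then `A x = λ x - y`. -/
def generatorGraph (T : ℝ → X →ₗ.[ℂ] X) : Set (X × X) :=
  {p | ∃ (ω : ℝ) (l : ℂ) (y : X), ω < l.re ∧ y ∈ sigmaSet T ω ∧
    p.1 = laplaceTransform T l y ∧ p.2 = l • p.1 - y}

/-- `A` is the generator of the semigroup `T`. -/
def IsGenerator (T : ℝ → X →ₗ.[ℂ] X) (A : X →ₗ.[ℂ] X) : Prop :=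
  (A.graph : Set (X × X)) = generatorGraph T

end Semigroup

/-! ### Weighted composition conjugations and operators on the Fock space -/

/-- The conditions on `a, b, c` under which `C_{a,b,c}` is a conjugation. -/
structure IsConjugationTriple (a b c : ℂ) : Prop where
  norm_a : ‖a‖ = 1
  ab : conj a * b + conj b = 0
  bc : ‖c‖ ^ 2 * Real.exp (‖b‖ ^ 2) = 1

theorem conjMap_measurePreserving {a : ℂ} (ha : ‖a‖ = 1) (b : ℂ) :
    MeasurePreserving (fun z : ℂ => conj (a * z + b)) ∧
      MeasurableEmbedding (fun z : ℂ => conj (a * z + b)) := by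
  let e : ℂ ≃ₗᵢ[ℝ] ℂ :=
    (rotation ⟨a, mem_sphere_zero_iff_norm.2 ha⟩).trans Complex.conjLIE
  have he : (fun z : ℂ => conj (a * z + b)) = (fun z => z + conj b) ∘ e := by
    funext z
    have h1 : e z = conj (a * z) := rfl
    simp [h1]
  rw [he]
  exact ⟨(measurePreserving_add_right volume (conj b)).comp e.measurePreserving,
    (Homeomorph.addRight (conj b)).measurableEmbedding.comp e.toHomeomorph.measurableEmbedding⟩

theorem conj_weight {a b c : ℂ} (h : IsConjugationTriple a b c) (f : ℂ → ℂ) (z : ℂ) :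
    Real.pi⁻¹ * Real.exp (-‖z‖ ^ 2) * ‖c * Complex.exp (b * z) * conj (f (conj (a * z + b)))‖ ^ 2 =
      Real.pi⁻¹ * Real.exp (-‖conj (a * z + b)‖ ^ 2) * ‖f (conj (a * z + b))‖ ^ 2 := by
  have h1 : ‖a * z + b‖ ^ 2 = ‖z‖ ^ 2 + ‖b‖ ^ 2 - 2 * (b * z).re := by
    have h2 : ((‖a * z + b‖ ^ 2 : ℝ) : ℂ) =
        ((‖z‖ ^ 2 + ‖b‖ ^ 2 : ℝ) : ℂ) - (b * z + conj (b * z)) := by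
      push_cast
      rw [← Complex.mul_conj', ← Complex.mul_conj', ← Complex.mul_conj']
      have haa : a * conj a = 1 := by rw [Complex.mul_conj', h.norm_a]; simp
      have hab := h.ab
      have hab' : a * conj b + b = 0 := by
        have := congrArg (starRingEnd ℂ) hab
        simpa using this
      simp only [map_add, map_mul]
      linear_combination z * conj z * haa + z * hab' + conj z * hab
    rw [Complex.add_conj] at h2
    exact_mod_cast h2
  rw [norm_mul, norm_mul, RCLike.norm_conj, RCLike.norm_conj, Complex.norm_exp, h1, mul_pow,
    mul_pow]
  have h3 : Real.exp (-(‖z‖ ^ 2 + ‖b‖ ^ 2 - 2 * (b * z).re)) =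
      Real.exp (-‖z‖ ^ 2) * Real.exp (b * z).re ^ 2 * (Real.exp (‖b‖ ^ 2))⁻¹ := by
    rw [← Real.exp_nat_mul, ← Real.exp_neg, ← Real.exp_add, ← Real.exp_add]
    congr 1
    push_cast
    ring
  have h4 : (Real.exp (‖b‖ ^ 2))⁻¹ = ‖c‖ ^ 2 := by
    rw [inv_eq_iff_eq_inv]
    exact eq_inv_of_mul_eq_one_right h.bc
  rw [h3, h4]
  ring

theorem conj_memFock {a b c : ℂ} (h : IsConjugationTriple a b c) {f : ℂ → ℂ} (hf : MemFock f) :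
    MemFock fun z => c * Complex.exp (b * z) * conj (f (conj (a * z + b))) := by
  have hd : Differentiable ℂ fun z => c * Complex.exp (b * z) * conj (f (conj (a * z + b))) := by
    have h1 : Differentiable ℂ fun z => conj (f (conj z)) := fun z => by
      have := (hf.differentiable (conj z)).conj_conj
      rw [Complex.conj_conj] at this
      exact this
    have h2 : Differentiable ℂ fun z => conj (f (conj (a * z + b))) :=
      h1.comp (by fun_prop : Differentiable ℂ fun z => a * z + b)
    exact (by fun_prop : Differentiable ℂ fun z => c * Complex.exp (b * z)).mul h2
  refine ⟨hd, (memLp_fock_iff hd.continuous).2 ?_⟩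
  simp_rw [conj_weight h]
  obtain ⟨hp, he⟩ := conjMap_measurePreserving h.norm_a b
  exact (hp.integrable_comp_emb he).2 ((memLp_fock_iff hf.differentiable.continuous).1 hf.memLp)

/-- The weighted composition conjugation
`(C_{a,b,c} f)(z) = c e^{bz} conj (f (conj (a z + b)))`. -/
def wcConj (a b c : ℂ) (h : IsConjugationTriple a b c) : Conjugation Fock where
  toFun :=
    { toFun := fun f =>
        ⟨fun z => c * Complex.exp (b * z) * conj (f (conj (a * z + b))), conj_memFock h f.memFock⟩
      map_add' := fun f g => Fock.ext fun z => by simp [Fock.add_apply, mul_add]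
      map_smul' := fun r f => Fock.ext fun z => by
        simp only [Fock.smul_apply, map_mul]
        ring }
  norm_map f := by
    obtain ⟨hp, he⟩ := conjMap_measurePreserving h.norm_a b
    refine (pow_left_inj₀ (norm_nonneg _) (norm_nonneg _) two_ne_zero).1 ?_
    rw [Fock.norm_sq_eq, Fock.norm_sq_eq]
    refine Eq.trans ?_ (hp.integral_comp he
      fun z => Real.pi⁻¹ * Real.exp (-‖z‖ ^ 2) * ‖f z‖ ^ 2)
    exact integral_congr_ae (Eventually.of_forall fun z => conj_weight h f z)
  involutive f := Fock.ext fun z => by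
    have haa : a * conj a = 1 := by rw [Complex.mul_conj', h.norm_a]; simp
    have hab' : a * conj b + b = 0 := by
      have := congrArg (starRingEnd ℂ) h.ab
      simpa using this
    have hz : conj (a * conj (a * z + b) + b) = z := by
      simp only [map_add, map_mul, Complex.conj_conj]
      linear_combination z * haa + h.ab
    have hcc : c * conj c * Complex.exp (b * conj b) = 1 := by
      rw [Complex.mul_conj', Complex.mul_conj', ← Complex.ofReal_pow, ← Complex.ofReal_pow,
        ← Complex.ofReal_exp, ← Complex.ofReal_mul, h.bc, Complex.ofReal_one]
    have hexp : Complex.exp (b * z) * Complex.exp (conj b * (a * z + b)) =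
        Complex.exp (b * conj b) := by
      rw [← Complex.exp_add]
      congr 1
      linear_combination z * hab'
    change c * Complex.exp (b * z) * conj (c * Complex.exp (b * conj (a * z + b)) *
      conj (f (conj (a * conj (a * z + b) + b)))) = f z
    rw [hz]
    simp only [map_mul, ← Complex.exp_conj, Complex.conj_conj]
    linear_combination (c * conj c * f z) * hexp + f z * hcc

/-- The maximal weighted composition operator `f ↦ ψ · f ∘ φ`. -/
def wcMax (ψ φ : ℂ → ℂ) : Fock →ₗ.[ℂ] Fock where
  domain :=
    { carrier := {f | MemFock fun z => ψ z * f (φ z)}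
      zero_mem' := by simpa [Fock.zero_apply] using MemFock.zero
      add_mem' := fun {f g} hf hg => by
        simpa [Fock.add_apply, mul_add] using MemFock.add hf hg
      smul_mem' := fun r f hf => by
        simpa [Fock.smul_apply, mul_left_comm] using MemFock.smul r hf }
  toFun :=
    { toFun := fun f => ⟨fun z => ψ z * f.1 (φ z), f.2⟩
      map_add' := fun f g => Fock.ext fun z => mul_add _ _ _
      map_smul' := fun r f => Fock.ext fun z => mul_left_comm _ _ _ }

/-- The translation semiflow `ζ_t(z) = z + E t`. -/
def transFlow (E : ℂ) (t : ℝ) (z : ℂ) : ℂ := z + E * t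

/-- The semicocycle `ξ_t(z) = exp (F t + a E² t² / 2) e^{a E t z}` of the translation semiflow. -/
def transCocycle (a E F : ℂ) (t : ℝ) (z : ℂ) : ℂ :=
  Complex.exp (F * t + a * E ^ 2 * t ^ 2 / 2) * Complex.exp (z * (a * E * t))

end

noncomputable section

/-! ### Reproducing formulas in the Fock space -/

/-! Write `L f = (F + aEz) f + E f'`. Since every `W t` is a restriction of a weighted translation,
orbits are explicit: `(W(t) f)(z) = ξ_t(z) f(z + Et)`, and the `t`-derivative of this is `ξ_t · (L
f) ∘ ζ_t`. Point evaluations are bounded on the Fock space, so identities between Bochner integrals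
can be checked pointwise.

Generator: a `C`-selfadjoint operator is closed, hence commutes with Bochner integrals. So a Laplace
transform `x = J_λ y` with `y ∈ Σ_ω` stays in `Σ_ω` (`laplaceTransform_mem_sigmaSet`), and
differentiating its orbit at time `0` gives `L x = λ x - y` (`laplaceTransform_ode`). Conversely
`e^{-λt} W(t)(λ f - L f)` is the derivative of `-e^{-λt} W(t) f`, so `f = J_λ(λ f - L f)`
(`eq_laplaceTransform`).

Symmetry: `J_λ` inherits `C`-symmetry from the `W t` (`inner_conj_laplaceTransform`), and `Q = λ -
J_λ⁻¹` inherits it from `J_λ`.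

Negative results: pairing with the kernels `1` and `z` evaluates a function or its derivative at
`0`, which shows that `C 1` lies in the domain of the adjoint of `Q`
(`inner_wcConj_transGenerator`). But `‖W(t) 1‖² = exp(2 Re F t + κ t²)` with `κ = Re(aE² + |E|²)`.
For `κ > 0` this beats every exponential, whereas domains of generators lie in the union of the
`Σ_ω`.

Point spectrum: the eigenvalue equation forces `f = K exp(qz - az²/2)`. Because `|a| = 1`, the
quadratic term exactly cancels the Gaussian weight along one line, so the weighted square does not
decay along it (`not_memFock_exp_quadratic`). -/

theorem integral_fockMeasure (h : ℂ → ℂ) :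
    ∫ z, h z ∂fockMeasure = ∫ z, ((Real.pi⁻¹ * Real.exp (-‖z‖ ^ 2) : ℝ) : ℂ) * h z := by
  rw [fockMeasure, integral_withDensity_eq_integral_toReal_smul measurable_fockDensity
    (Eventually.of_forall fun z => ENNReal.ofReal_lt_top)]
  refine integral_congr_ae (Eventually.of_forall fun z => ?_)
  simp only
  rw [ENNReal.toReal_ofReal (by positivity), Complex.real_smul]

theorem integrable_fockMeasure_iff (h : ℂ → ℂ) : Integrable h fockMeasure ↔
    Integrable fun z => ((Real.pi⁻¹ * Real.exp (-‖z‖ ^ 2) : ℝ) : ℂ) * h z := by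
  rw [fockMeasure, integrable_withDensity_iff_integrable_smul' measurable_fockDensity
    (Eventually.of_forall fun z => ENNReal.ofReal_lt_top)]
  refine integrable_congr (Eventually.of_forall fun z => ?_)
  simp only
  rw [ENNReal.toReal_ofReal (by positivity), Complex.real_smul]

/-- The substitution `u = r²` gives `Γ(n + 1)`. The weight `2 r e^{-r²}` is what the Gaussian
measure leaves on radii once the angle is averaged out. -/
theorem integral_gaussian_odd_moment (n : ℕ) :
    ∫ r in Ioi (0 : ℝ), 2 * r * Real.exp (-r ^ 2) * r ^ (2 * n) = n.factorial := by
  have h := integral_rpow_mul_exp_neg_rpow (p := 2) (q := 2 * n + 1) (by norm_num)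
    (by have : (0 : ℝ) ≤ n := n.cast_nonneg
        linarith)
  have h2 : ((2 * n + 1 + 1) / 2 : ℝ) = n + 1 := by ring
  rw [h2, Real.Gamma_nat_eq_factorial] at h
  calc ∫ r in Ioi (0 : ℝ), 2 * r * Real.exp (-r ^ 2) * r ^ (2 * n)
      = ∫ r in Ioi (0 : ℝ), 2 * (r ^ (2 * (n : ℝ) + 1) * Real.exp (-r ^ (2 : ℝ))) := by
        refine setIntegral_congr_fun measurableSet_Ioi fun r hr => ?_
        have h3 : r ^ (2 * (n : ℝ) + 1) = r ^ (2 * n + 1) := by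
          rw [← Real.rpow_natCast]
          push_cast
          rfl
        simp only [h3, Real.rpow_two]
        ring
    _ = n.factorial := by
        rw [integral_const_mul, h]
        ring

/-- Gaussian integration of a function whose mean over every circle about the origin is a multiple
of an even power of the radius. -/
theorem integral_fockMeasure_of_circleAverage {h : ℂ → ℂ} (hc : Continuous h)
    (hi : Integrable h fockMeasure) {n : ℕ} {v : ℂ}
    (hv : ∀ r : ℝ, 0 < r → Real.circleAverage h 0 r = (r : ℂ) ^ (2 * n) * v) :
    ∫ z, h z ∂fockMeasure = n.factorial * v := by
  rw [integrable_fockMeasure_iff] at hi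
  rw [integral_fockMeasure, ← Complex.integral_comp_polarCoord_symm]
  set H : ℂ → ℂ := fun z => ((Real.pi⁻¹ * Real.exp (-‖z‖ ^ 2) : ℝ) : ℂ) * h z with hH
  have hHc : Continuous H := by fun_prop
  have hpc : Continuous (Complex.polarCoord.symm : ℝ × ℝ → ℂ) := by
    have : (Complex.polarCoord.symm : ℝ × ℝ → ℂ) =
        fun p => (p.1 : ℂ) * (Real.cos p.2 + Real.sin p.2 * Complex.I) := by
      funext p
      simp
    rw [this]
    fun_prop
  -- Integrability for Fubini comes from the polar formula for the lower integral of the norm.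
  have hint : IntegrableOn (fun p : ℝ × ℝ => p.1 • H (Complex.polarCoord.symm p))
      polarCoord.target := by
    refine ⟨(continuous_fst.smul (hHc.comp hpc)).aestronglyMeasurable, ?_⟩
    have h1 := hi.hasFiniteIntegral
    rw [hasFiniteIntegral_iff_enorm, ← Complex.lintegral_comp_polarCoord_symm] at h1
    rw [hasFiniteIntegral_iff_enorm]
    refine lt_of_eq_of_lt ?_ h1
    refine setLIntegral_congr_fun polarCoord.open_target.measurableSet fun p hp => ?_
    have hp1 : 0 < p.1 := hp.1
    simp only [enorm_smul, smul_eq_mul]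
    rw [Real.enorm_of_nonneg hp1.le]
  rw [show polarCoord.target = Ioi (0 : ℝ) ×ˢ Ioo (-Real.pi) Real.pi from rfl,
    Measure.volume_eq_prod] at hint ⊢
  rw [setIntegral_prod _ hint]
  have hin : ∀ r ∈ Ioi (0 : ℝ), ∫ θ in Ioo (-Real.pi) Real.pi,
      (r, θ).1 • H (Complex.polarCoord.symm (r, θ)) =
      ((2 * r * Real.exp (-r ^ 2) * r ^ (2 * n) : ℝ) : ℂ) * v := by
    intro r hr
    have hr' : 0 < r := hr
    have h1 := hv r hr'
    rw [Real.circleAverage_eq_integral_add (-Real.pi),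
      intervalIntegral.integral_comp_add_right (fun θ => h (circleMap 0 r θ)), zero_add,
      show 2 * Real.pi + -Real.pi = Real.pi by ring,
      intervalIntegral.integral_of_le (by linarith [Real.pi_pos]),
      integral_Ioc_eq_integral_Ioo, Complex.real_smul] at h1
    have h2 : ∀ θ : ℝ, (r, θ).1 • H (Complex.polarCoord.symm (r, θ)) =
        ((r * (Real.pi⁻¹ * Real.exp (-r ^ 2)) : ℝ) : ℂ) * h (circleMap 0 r θ) := by
      intro θ
      have h3 : Complex.polarCoord.symm (r, θ) = circleMap 0 r θ := by
        simp [circleMap, Complex.exp_mul_I]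
      rw [h3, hH, Complex.real_smul]
      simp only [norm_circleMap_zero, sq_abs]
      push_cast
      ring
    simp_rw [h2]
    rw [integral_const_mul]
    have hpi : (Real.pi : ℂ) ≠ 0 := by exact_mod_cast Real.pi_ne_zero
    push_cast at h1 ⊢
    rw [inv_mul_eq_iff_eq_mul₀ (by simp)] at h1
    rw [h1]
    field_simp
  rw [setIntegral_congr_fun measurableSet_Ioi hin, integral_mul_const, integral_complex_ofReal,
    integral_gaussian_odd_moment]
  simp

/-- The mean value property: all circle averages equal `h 0`, the case `n = 0` above. -/
theorem integral_fockMeasure_eq_zero_apply {h : ℂ → ℂ} (hd : Differentiable ℂ h)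
    (hi : Integrable h fockMeasure) : ∫ z, h z ∂fockMeasure = h 0 := by
  have := integral_fockMeasure_of_circleAverage hd.continuous hi (n := 0) (v := h 0)
    fun r _ => by simpa using DiffContOnCl.circleAverage hd.diffContOnCl
  simpa using this

/-- On `|z| = r` one has `conj z * z = r²`, so splitting `h = h 0 + z * dslope h 0` turns the
integrand into an antiholomorphic part of mean zero plus `r²` times an entire function with value
`deriv h 0` at `0`. -/
theorem integral_fockMeasure_conj_mul {h : ℂ → ℂ} (hd : Differentiable ℂ h)
    (hi : Integrable (fun z => conj z * h z) fockMeasure) :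
    ∫ z, conj z * h z ∂fockMeasure = deriv h 0 := by
  have hcont := hd.continuous
  have hk : Differentiable ℂ (dslope h 0) := by
    rw [← differentiableOn_univ, Complex.differentiableOn_dslope univ_mem]
    exact hd.differentiableOn
  have := integral_fockMeasure_of_circleAverage (h := fun z => conj z * h z) (by fun_prop) hi
    (n := 1) (v := deriv h 0) fun r hr => by
      have h1 : Real.circleAverage (fun z => conj z * h z) 0 r =
          Real.circleAverage (fun z => conj (z * conj (h 0)) + (r : ℂ) ^ 2 * dslope h 0 z) 0 r := by
        refine Real.circleAverage_congr_sphere fun z hz => ?_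
        have hz' : conj z * z = (r : ℂ) ^ 2 := by
          rw [mem_sphere_zero_iff_norm] at hz
          rw [Complex.conj_mul', hz]
          norm_cast
          rw [sq_abs]
        have h2 : h z = h 0 + z * dslope h 0 z := by
          have := sub_smul_dslope h 0 z
          simp only [sub_zero, smul_eq_mul] at this
          rw [this]
          ring
        simp only [map_mul, Complex.conj_conj]
        rw [h2, ← hz']
        ring
      have hc1 : Continuous fun z : ℂ => conj (z * conj (h 0)) := by fun_prop
      have hc2 : Continuous fun z : ℂ => (r : ℂ) ^ 2 * dslope h 0 z :=
        continuous_const.mul hk.continuous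
      have h3 : Real.circleAverage (fun z : ℂ => conj (z * conj (h 0))) 0 r = 0 := by
        have h4 : Real.circleAverage (fun z : ℂ => z * conj (h 0)) 0 r = 0 := by
          have hl : Differentiable ℂ fun z : ℂ => z * conj (h 0) := by fun_prop
          simpa using (DiffContOnCl.circleAverage (c := 0) (R := r) hl.diffContOnCl)
        have h5 := (Complex.conjCLE.toContinuousLinearMap).circleAverage_comp_comm
          (f := fun z : ℂ => z * conj (h 0)) (c := 0) (R := r)
          (Continuous.continuousOn (by fun_prop)).circleIntegrable'
        rw [h4] at h5
        simpa [Function.comp_def] using h5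
      have hd2 : Differentiable ℂ fun z : ℂ => (r : ℂ) ^ 2 * dslope h 0 z := hk.const_mul _
      rw [h1, Real.circleAverage_fun_add hc1.continuousOn.circleIntegrable'
        hc2.continuousOn.circleIntegrable', h3,
        DiffContOnCl.circleAverage hd2.diffContOnCl]
      simp
  simpa using this

theorem memFock_of_norm_le_exp {f : ℂ → ℂ} (hd : Differentiable ℂ f) {R : ℝ}
    (hf : ∀ z, ‖f z‖ ≤ Real.exp (R * ‖z‖)) : MemFock f := by
  refine ⟨hd, (memLp_fock_iff hd.continuous).2 ?_⟩
  have hc := hd.continuous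
  -- A non-integrable function would have integral `0` by convention, but the closed formula is
  -- positive.
  have h0 : Integrable fun z : ℂ => Real.exp (-(1 / 2) * ‖z‖ ^ (2 : ℝ)) := by
    by_contra hn
    have h1 := Complex.integral_exp_neg_mul_rpow (p := 2) (b := 1 / 2) (by norm_num) (by norm_num)
    rw [integral_undef hn] at h1
    have : 0 < Real.Gamma (2 / 2 + 1) := Real.Gamma_pos_of_pos (by norm_num)
    have h2 : (0 : ℝ) < Real.pi * (1 / 2) ^ (-2 / 2 : ℝ) * Real.Gamma (2 / 2 + 1) := by positivity
    exact h2.ne h1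
  refine (h0.const_mul (Real.pi⁻¹ * Real.exp (2 * R ^ 2))).mono'
    (Continuous.aestronglyMeasurable (by fun_prop)) (Eventually.of_forall fun z => ?_)
  rw [Real.norm_of_nonneg (by positivity), mul_assoc, mul_assoc]
  refine mul_le_mul_of_nonneg_left ?_ (by positivity)
  calc Real.exp (-‖z‖ ^ 2) * ‖f z‖ ^ 2
      ≤ Real.exp (-‖z‖ ^ 2) * Real.exp (R * ‖z‖) ^ 2 := by gcongr; exact hf z
    _ = Real.exp (-‖z‖ ^ 2 + 2 * (R * ‖z‖)) := by
        rw [Real.exp_add, ← Real.exp_nat_mul]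
        norm_num
    _ ≤ Real.exp (2 * R ^ 2 + -(1 / 2) * ‖z‖ ^ (2 : ℝ)) := by
        rw [Real.rpow_two]
        refine Real.exp_le_exp.2 ?_
        nlinarith [sq_nonneg (‖z‖ - 2 * R)]
    _ = _ := by rw [Real.exp_add]

namespace Fock

/-- The function `z ↦ e^{q z}`. -/
def expFun (q : ℂ) : Fock := ⟨fun z => Complex.exp (q * z),
  memFock_of_norm_le_exp (R := ‖q‖) (by fun_prop) fun z => by
    rw [Complex.norm_exp, ← norm_mul]
    exact Real.exp_le_exp.2 (Complex.re_le_norm _)⟩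

/-- The function `z ↦ z`. -/
def coord : Fock := ⟨fun z => z, memFock_of_norm_le_exp (R := 1) (by fun_prop) fun z => by
  rw [one_mul]
  linarith [Real.add_one_le_exp ‖z‖]⟩

theorem expFun_apply (q z : ℂ) : expFun q z = Complex.exp (q * z) := rfl

theorem integrable_conj_mul (f g : Fock) : Integrable (fun z => conj (f z) * g z) fockMeasure := by
  have h := L2.integrable_inner (𝕜 := ℂ) (toL2 f) (toL2 g)
  refine h.congr ?_
  filter_upwards [f.memLp.coeFn_toLp, g.memLp.coeFn_toLp] with z hf hg
  change inner ℂ (f.memLp.toLp f z) (g.memLp.toLp g z) = _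
  rw [hf, hg]
  simp [mul_comm]

/-- The functions `z ↦ e^{q z}` are the reproducing kernels of the Fock space. -/
theorem inner_expFun (q : ℂ) (g : Fock) : inner ℂ (expFun q) g = g (conj q) := by
  rw [inner_eq]
  have hi : Integrable (fun z => conj (expFun q z) * g z) fockMeasure := integrable_conj_mul _ _
  rw [integrable_fockMeasure_iff] at hi
  rw [integral_fockMeasure]
  -- Recentring at `conj q` completes the square: the kernel is absorbed by the Gaussian and leaves
  -- the entire factor `exp(-q w)`, so only the value at `w = 0` survives.
  have h1 : ∀ w, ((Real.pi⁻¹ * Real.exp (-‖w + conj q‖ ^ 2) : ℝ) : ℂ) *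
      (conj (expFun q (w + conj q)) * g (w + conj q)) =
      ((Real.pi⁻¹ * Real.exp (-‖w‖ ^ 2) : ℝ) : ℂ) *
        (Complex.exp (-(q * w)) * g (w + conj q)) := by
    intro w
    rw [expFun_apply, ← Complex.exp_conj]
    push_cast
    rw [← Complex.mul_conj', ← Complex.mul_conj']
    have h2 : Complex.exp (-((w + conj q) * conj (w + conj q))) *
        Complex.exp (conj (q * (w + conj q))) =
        Complex.exp (-(w * conj w)) * Complex.exp (-(q * w)) := by
      rw [← Complex.exp_add, ← Complex.exp_add]
      congr 1
      simp only [map_add, map_mul, Complex.conj_conj]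
      ring
    linear_combination (Real.pi : ℂ)⁻¹ * g (w + conj q) * h2
  have hi2 := hi.comp_add_right (conj q)
  rw [← integral_add_right_eq_self _ (conj q)]
  simp_rw [h1] at hi2 ⊢
  rw [← integral_fockMeasure, integral_fockMeasure_eq_zero_apply]
  · simp
  · have := g.differentiable
    fun_prop
  · rwa [integrable_fockMeasure_iff]

theorem inner_coord (g : Fock) : inner ℂ coord g = deriv g 0 := by
  rw [inner_eq]
  exact integral_fockMeasure_conj_mul g.differentiable (integrable_conj_mul coord g)

theorem norm_expFun_sq (q : ℂ) : ‖expFun q‖ ^ 2 = Real.exp (‖q‖ ^ 2) := by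
  have h1 := inner_self_eq_norm_sq_to_K (𝕜 := ℂ) (expFun q)
  rw [inner_expFun, expFun_apply, Complex.mul_conj'] at h1
  have h2 : ((‖expFun q‖ ^ 2 : ℝ) : ℂ) = (Real.exp (‖q‖ ^ 2) : ℝ) := by
    push_cast
    exact h1.symm
  exact_mod_cast h2

end Fock

/-! ### Closed operators, orbits and Laplace transforms -/

section GeneralSemigroup

variable {X : Type*} [NormedAddCommGroup X] [NormedSpace ℂ X]

/-- The quotient map by a closed subspace is continuous and linear into a normed space, so it
commutes with the integral, and it kills the integrand. -/
theorem Submodule.integral_mem_of_isClosed {Y : Type*} [NormedAddCommGroup Y] [NormedSpace ℂ Y]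
    [CompleteSpace Y] {S : Submodule ℂ Y} (hS : IsClosed (S : Set Y)) {α : Type*}
    [MeasurableSpace α] {μ : Measure α} {f : α → Y} (hf : Integrable f μ)
    (h : ∀ᵐ x ∂μ, f x ∈ S) : ∫ x, f x ∂μ ∈ S := by
  have : IsClosed (S : Set Y) := hS
  rw [← Submodule.Quotient.mk_eq_zero, ← Submodule.mkQ_apply, ← Submodule.mkQL_apply,
    ← ContinuousLinearMap.integral_comp_comm _ hf]
  refine integral_eq_zero_of_ae ?_
  filter_upwards [h] with x hx
  simpa using hx

/-- Hille's theorem: integrate pairs inside the closed subspace `T.graph` of the product. -/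
theorem LinearPMap.IsClosed.integral_mem_graph [CompleteSpace X] {T : X →ₗ.[ℂ] X}
    (hT : T.IsClosed) {α : Type*} [MeasurableSpace α] {μ : Measure α} {f g : α → X}
    (hf : Integrable f μ) (hg : Integrable g μ) (h : ∀ᵐ x ∂μ, (f x, g x) ∈ T.graph) :
    (∫ x, f x ∂μ, ∫ x, g x ∂μ) ∈ T.graph := by
  rw [← integral_pair hf hg]
  exact Submodule.integral_mem_of_isClosed hT (hf.prodMk hg) h

theorem mem_graph_of_mem_domain {T : X →ₗ.[ℂ] X} {x : X} (h : x ∈ T.domain) :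
    (x, T ⟨x, h⟩) ∈ T.graph := T.mem_graph ⟨x, h⟩

theorem orbit_mem_graph {T : ℝ → X →ₗ.[ℂ] X} {x : X} {t : ℝ} (h : x ∈ (T t).domain) :
    (x, orbit T x t) ∈ (T t).graph := by
  rw [orbit, dif_pos h]
  exact mem_graph_of_mem_domain h

theorem orbit_eq_of_mem_graph {T : ℝ → X →ₗ.[ℂ] X} {x v : X} {t : ℝ} (h : (x, v) ∈ (T t).graph) :
    orbit T x t = v := by
  have h1 : x ∈ (T t).domain := LinearPMap.mem_domain_of_mem_graph h
  exact (T t).mem_graph_snd_inj (orbit_mem_graph h1) h rfl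

/-- Graph membership replaces nested domain proofs; linearity and closedness arguments then become
statements about subspaces. -/
theorem mem_semigroupVectors_iff {T : ℝ → X →ₗ.[ℂ] X} {x : X} : x ∈ semigroupVectors T ↔
    (∀ t, 0 ≤ t → (x, orbit T x t) ∈ (T t).graph) ∧
      (∀ t s, 0 ≤ t → 0 ≤ s → (orbit T x s, orbit T x (t + s)) ∈ (T t).graph) ∧
      ContinuousOn (orbit T x) (Ioi 0) ∧ Tendsto (orbit T x) (𝓝[>] 0) (𝓝 x) := by
  constructor
  · rintro ⟨h1, h2, h3⟩
    refine ⟨fun t ht => ?_, fun t s ht hs => ?_, h2, h3⟩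
    · obtain ⟨hs, -, -⟩ := h1 t t ht ht
      exact orbit_mem_graph hs
    · obtain ⟨hs, hts, h, he⟩ := h1 t s ht hs
      rw [orbit, orbit, dif_pos hs, dif_pos h, ← he]
      exact mem_graph_of_mem_domain hts
  · rintro ⟨h0, h1, h2, h3⟩
    refine ⟨fun t s ht hs => ?_, h2, h3⟩
    have hs' := LinearPMap.mem_domain_of_mem_graph (h0 s hs)
    have h := LinearPMap.mem_domain_of_mem_graph (h0 _ (add_nonneg ht hs))
    have h4 := h1 t s ht hs
    rw [orbit, orbit, dif_pos hs', dif_pos h] at h4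
    have hts := LinearPMap.mem_domain_of_mem_graph h4
    exact ⟨hs', hts, h, (T t).mem_graph_snd_inj (mem_graph_of_mem_domain hts) h4 rfl⟩

theorem mem_sigmaSet_iff {T : ℝ → X →ₗ.[ℂ] X} {ω : ℝ} {x : X} : x ∈ sigmaSet T ω ↔
    x ∈ semigroupVectors T ∧ ∃ M : ℝ, 0 ≤ M ∧ ∀ t, 0 ≤ t → ‖orbit T x t‖ ≤ M * Real.exp (ω * t) := by
  refine and_congr_right fun _ => ⟨fun h => ?_, ?_⟩
  · refine ⟨(growthNorm T ω x).toReal, ENNReal.toReal_nonneg, fun t ht => ?_⟩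
    have h1 : ENNReal.ofReal (Real.exp (-ω * t) * ‖orbit T x t‖) ≤ growthNorm T ω x :=
      le_iSup₂ (f := fun t (_ : t ∈ Ici (0 : ℝ)) =>
        ENNReal.ofReal (Real.exp (-ω * t) * ‖orbit T x t‖)) t ht
    rw [ENNReal.ofReal_le_iff_le_toReal h.ne] at h1
    calc ‖orbit T x t‖ = Real.exp (-ω * t) * ‖orbit T x t‖ * Real.exp (ω * t) := by
          rw [mul_right_comm, ← Real.exp_add]
          simp
      _ ≤ _ := by gcongr
  · rintro ⟨M, hM, h⟩
    refine lt_of_le_of_lt (iSup₂_le fun t ht => ?_) (ENNReal.ofReal_lt_top (r := M))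
    apply ENNReal.ofReal_le_ofReal
    calc Real.exp (-ω * t) * ‖orbit T x t‖
        ≤ Real.exp (-ω * t) * (M * Real.exp (ω * t)) := by gcongr; exact h t ht
      _ = M * Real.exp (-ω * t + ω * t) := by rw [Real.exp_add]; ring
      _ = M := by simp

theorem semigroupVectors_zero (T : ℝ → X →ₗ.[ℂ] X) : (0 : X) ∈ semigroupVectors T := by
  have h0 : orbit T (0 : X) = fun _ => 0 := by
    funext t
    exact orbit_eq_of_mem_graph (T t).graph.zero_mem
  rw [mem_semigroupVectors_iff, h0]
  exact ⟨fun t _ => (T t).graph.zero_mem, fun t _ _ _ => (T t).graph.zero_mem,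
    continuousOn_const, tendsto_const_nhds⟩

theorem orbit_linear_combination {T : ℝ → X →ₗ.[ℂ] X} {x y : X} (hx : x ∈ semigroupVectors T)
    (hy : y ∈ semigroupVectors T) (c d : ℂ) {t : ℝ} (ht : 0 ≤ t) :
    orbit T (c • x + d • y) t = c • orbit T x t + d • orbit T y t := by
  rw [mem_semigroupVectors_iff] at hx hy
  exact orbit_eq_of_mem_graph ((T t).graph.add_mem ((T t).graph.smul_mem c (hx.1 t ht))
    ((T t).graph.smul_mem d (hy.1 t ht)))

theorem semigroupVectors_linear_combination {T : ℝ → X →ₗ.[ℂ] X} {x y : X}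
    (hx : x ∈ semigroupVectors T) (hy : y ∈ semigroupVectors T) (c d : ℂ) :
    c • x + d • y ∈ semigroupVectors T := by
  have ho := fun t ht => orbit_linear_combination (t := t) hx hy c d ht
  rw [mem_semigroupVectors_iff] at hx hy ⊢
  refine ⟨fun t ht => ?_, fun t s ht hs => ?_, ?_, ?_⟩
  · rw [ho t ht]
    exact (T t).graph.add_mem ((T t).graph.smul_mem c (hx.1 t ht))
      ((T t).graph.smul_mem d (hy.1 t ht))
  · rw [ho s hs, ho _ (add_nonneg ht hs)]
    exact (T t).graph.add_mem ((T t).graph.smul_mem c (hx.2.1 t s ht hs))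
      ((T t).graph.smul_mem d (hy.2.1 t s ht hs))
  · exact ((hx.2.2.1.const_smul c).add (hy.2.2.1.const_smul d)).congr fun t ht => ho t ht.out.le
  · refine ((hx.2.2.2.const_smul c).add (hy.2.2.2.const_smul d)).congr' ?_
    filter_upwards [self_mem_nhdsWithin] with t ht
    exact (ho t ht.out.le).symm

/-- The vectors whose orbits grow at most like `e^{ωt}`, as a subspace. -/
def sigmaSubmodule (T : ℝ → X →ₗ.[ℂ] X) (ω : ℝ) : Submodule ℂ X where
  carrier := sigmaSet T ω
  zero_mem' := by
    rw [mem_sigmaSet_iff]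
    refine ⟨semigroupVectors_zero T, 0, le_rfl, fun t _ => ?_⟩
    rw [orbit_eq_of_mem_graph (T t).graph.zero_mem]
    simp
  add_mem' {x y} hx hy := by
    rw [mem_sigmaSet_iff] at *
    obtain ⟨hx, M, hM, hxM⟩ := hx
    obtain ⟨hy, N, hN, hyN⟩ := hy
    have h1 := semigroupVectors_linear_combination hx hy 1 1
    have h2 := fun t ht => orbit_linear_combination (t := t) hx hy 1 1 ht
    simp only [one_smul] at h1 h2
    refine ⟨h1, M + N, add_nonneg hM hN, fun t ht => ?_⟩
    rw [h2 t ht, add_mul]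
    exact (norm_add_le _ _).trans (add_le_add (hxM t ht) (hyN t ht))
  smul_mem' c x hx := by
    rw [mem_sigmaSet_iff] at *
    obtain ⟨hx, M, hM, hxM⟩ := hx
    have h1 := semigroupVectors_linear_combination hx hx c 0
    have h2 := fun t ht => orbit_linear_combination (t := t) hx hx c 0 ht
    simp only [zero_smul, add_zero] at h1 h2
    refine ⟨h1, ‖c‖ * M, by positivity, fun t ht => ?_⟩
    rw [h2 t ht, norm_smul, mul_assoc]
    gcongr
    exact hxM t ht

theorem sigmaSet_mono (T : ℝ → X →ₗ.[ℂ] X) {ω ω' : ℝ} (h : ω ≤ ω') :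
    sigmaSet T ω ⊆ sigmaSet T ω' := by
  intro x hx
  rw [mem_sigmaSet_iff] at *
  obtain ⟨hx, M, hM, hxM⟩ := hx
  refine ⟨hx, M, hM, fun t ht => (hxM t ht).trans ?_⟩
  gcongr

theorem norm_cexp_neg_mul (l : ℂ) (t : ℝ) : ‖Complex.exp (-l * t)‖ = Real.exp (-l.re * t) := by
  simp [Complex.norm_exp]

theorem integrableOn_exp_mul_exp {l ω : ℝ} (h : ω < l) (M : ℝ) :
    IntegrableOn (fun t => Real.exp (-l * t) * (M * Real.exp (ω * t))) (Ioi 0) := by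
  have h1 := (integrableOn_exp_mul_Ioi (a := ω - l) (by linarith) 0).const_mul M
  refine IntegrableOn.congr_fun h1 (fun t _ => ?_) measurableSet_Ioi
  rw [sub_mul, Real.exp_sub, neg_mul, Real.exp_neg]
  ring

variable {T : ℝ → X →ₗ.[ℂ] X} {ω : ℝ} {y : X} {l : ℂ}

theorem continuousOn_exp_smul_orbit (hy : y ∈ semigroupVectors T) {s : ℝ} (hs : 0 ≤ s) :
    ContinuousOn (fun t : ℝ => Complex.exp (-l * t) • orbit T y (t + s)) (Ioi 0) := by
  have h1 := (mem_semigroupVectors_iff.1 hy).2.2.1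
  refine ContinuousOn.smul (by fun_prop) (h1.comp (by fun_prop) fun t ht => ?_)
  have := ht.out
  simp only [mem_Ioi]
  linarith

theorem integrableOn_exp_smul_orbit (hy : y ∈ sigmaSet T ω) (hl : ω < l.re) {s : ℝ} (hs : 0 ≤ s) :
    IntegrableOn (fun t : ℝ => Complex.exp (-l * t) • orbit T y (t + s)) (Ioi 0) := by
  obtain ⟨hy, M, hM, hyM⟩ := mem_sigmaSet_iff.1 hy
  refine (integrableOn_exp_mul_exp hl (M * Real.exp (ω * s))).mono'
    ((continuousOn_exp_smul_orbit hy hs).aestronglyMeasurable measurableSet_Ioi) ?_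
  filter_upwards [ae_restrict_mem measurableSet_Ioi] with t ht
  rw [norm_smul, norm_cexp_neg_mul]
  gcongr
  refine (hyM _ (add_nonneg ht.out.le hs)).trans_eq ?_
  rw [mul_add, Real.exp_add]
  ring

/-- Dominated convergence. The endpoint `s = 0` is allowed because `r + s > 0` for the integration
variable `r > 0`, where the orbit is continuous. -/
theorem continuousWithinAt_shifted_laplaceTransform (hy : y ∈ sigmaSet T ω) (hl : ω < l.re) {s : ℝ}
    (hs : 0 ≤ s) : ContinuousWithinAt
      (fun s : ℝ => ∫ r in Ioi (0 : ℝ), Complex.exp (-l * r) • orbit T y (r + s)) (Ici 0) s := by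
  obtain ⟨hy', M, hM, hyM⟩ := mem_sigmaSet_iff.1 hy
  refine continuousWithinAt_of_dominated
    -- The factor `exp(|ω| (s + 1))` dominates `exp(ω r)` for all `0 ≤ r < s + 1`, whatever the sign
    -- of `ω`.
    (bound := fun t => Real.exp (-l.re * t) * ((M * Real.exp (|ω| * (s + 1))) * Real.exp (ω * t)))
    ?_ ?_ (integrableOn_exp_mul_exp hl _) ?_
  · filter_upwards [self_mem_nhdsWithin] with r hr
    exact (continuousOn_exp_smul_orbit hy' hr).aestronglyMeasurable measurableSet_Ioi
  · filter_upwards [self_mem_nhdsWithin,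
      mem_nhdsWithin_of_mem_nhds (Iio_mem_nhds (lt_add_one s))] with r hr hr1
    filter_upwards [ae_restrict_mem measurableSet_Ioi] with t ht
    rw [norm_smul, norm_cexp_neg_mul]
    gcongr
    refine (hyM _ (add_nonneg ht.out.le hr)).trans ?_
    rw [mul_assoc, ← Real.exp_add]
    gcongr
    have h1 : ω * r ≤ |ω| * (s + 1) :=
      mul_le_mul (le_abs_self ω) hr1.out.le hr (abs_nonneg ω)
    linarith
  · filter_upwards [ae_restrict_mem measurableSet_Ioi] with t ht
    have h1 : ContinuousAt (orbit T y) (t + s) :=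
      (mem_semigroupVectors_iff.1 hy').2.2.1.continuousAt
        (Ioi_mem_nhds (add_pos_of_pos_of_nonneg ht.out hs))
    have h2 : ContinuousAt (fun s : ℝ => orbit T y (t + s)) s :=
      ContinuousAt.comp (g := orbit T y) h1 (by fun_prop)
    exact (h2.const_smul _).continuousWithinAt

variable [CompleteSpace X]

/-- Closed operators `T(s)` commute with the Laplace transform. -/
theorem laplaceTransform_mem_graph (hT : ∀ t, 0 ≤ t → (T t).IsClosed) (hy : y ∈ sigmaSet T ω)
    (hl : ω < l.re) {t s : ℝ} (ht : 0 ≤ t) (hs : 0 ≤ s) :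
    (∫ r in Ioi (0 : ℝ), Complex.exp (-l * r) • orbit T y (r + s),
      ∫ r in Ioi (0 : ℝ), Complex.exp (-l * r) • orbit T y (r + (t + s))) ∈ (T t).graph := by
  refine (hT t ht).integral_mem_graph (integrableOn_exp_smul_orbit hy hl hs)
    (integrableOn_exp_smul_orbit hy hl (add_nonneg ht hs)) ?_
  filter_upwards [ae_restrict_mem measurableSet_Ioi] with r hr
  have h1 := (mem_semigroupVectors_iff.1 hy.1).2.1 t (r + s) ht (add_nonneg hr.out.le hs)
  rw [show t + (r + s) = r + (t + s) by ring] at h1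
  exact (T t).graph.smul_mem _ h1

theorem laplaceTransform_mem_domain_graph (hT : ∀ t, 0 ≤ t → (T t).IsClosed) (hy : y ∈ sigmaSet T ω)
    (hl : ω < l.re) {t : ℝ} (ht : 0 ≤ t) :
    (laplaceTransform T l y,
      ∫ r in Ioi (0 : ℝ), Complex.exp (-l * r) • orbit T y (r + t)) ∈ (T t).graph := by
  have h := laplaceTransform_mem_graph hT hy hl ht le_rfl
  simp only [add_zero] at h
  exact h

theorem orbit_laplaceTransform (hT : ∀ t, 0 ≤ t → (T t).IsClosed) (hy : y ∈ sigmaSet T ω)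
    (hl : ω < l.re) {t : ℝ} (ht : 0 ≤ t) : orbit T (laplaceTransform T l y) t =
      ∫ r in Ioi (0 : ℝ), Complex.exp (-l * r) • orbit T y (r + t) :=
  orbit_eq_of_mem_graph (laplaceTransform_mem_domain_graph hT hy hl ht)

/-- Closedness lets `T s` pass under the integral, so the orbit is the Laplace integral of the
shifted orbit of `y`. The semigroup law and continuity are then inherited, and the shift costs only
a factor `e^{ωs}`. -/
theorem laplaceTransform_mem_sigmaSet (hT : ∀ t, 0 ≤ t → (T t).IsClosed) (hy : y ∈ sigmaSet T ω)
    (hl : ω < l.re) : laplaceTransform T l y ∈ sigmaSet T ω := by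
  have ho := fun t ht => orbit_laplaceTransform (t := t) hT hy hl ht
  obtain ⟨hy', M, hM, hyM⟩ := mem_sigmaSet_iff.1 hy
  rw [mem_sigmaSet_iff, mem_semigroupVectors_iff]
  refine ⟨⟨fun t ht => ?_, fun t s ht hs => ?_, ?_, ?_⟩,
    ∫ r in Ioi (0 : ℝ), Real.exp (-l.re * r) * (M * Real.exp (ω * r)), ?_, fun t ht => ?_⟩
  · rw [ho t ht]
    exact laplaceTransform_mem_domain_graph hT hy hl ht
  · rw [ho s hs, ho _ (add_nonneg ht hs)]
    exact laplaceTransform_mem_graph hT hy hl ht hs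
  · intro t ht
    exact ((continuousWithinAt_shifted_laplaceTransform hy hl ht.out.le).mono
      Ioi_subset_Ici_self).congr (fun s hs => ho s hs.out.le) (ho t ht.out.le)
  · have h1 := continuousWithinAt_shifted_laplaceTransform hy hl le_rfl
    have h2 := (h1.mono Ioi_subset_Ici_self).tendsto
    simp only [add_zero] at h2
    refine h2.congr' ?_
    filter_upwards [self_mem_nhdsWithin] with t ht
    exact (ho t ht.out.le).symm
  · exact integral_nonneg fun r => by positivity
  · rw [ho t ht, ← integral_mul_const]
    refine norm_integral_le_of_norm_le ((integrableOn_exp_mul_exp hl M).mul_const _) ?_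
    filter_upwards [ae_restrict_mem measurableSet_Ioi] with r hr
    rw [norm_smul, norm_cexp_neg_mul, mul_assoc]
    gcongr
    refine (hyM _ (add_nonneg hr.out.le ht)).trans_eq ?_
    rw [mul_add, Real.exp_add]
    ring

end GeneralSemigroup

/-! ### Conjugations and adjoints -/

section Conj

variable {H : Type*} [NormedAddCommGroup H] [InnerProductSpace ℂ H]

namespace Conjugation

/-- Polarization: norms are preserved, while antilinearity gives `I • C y = C (-(I • y))`, which
exchanges the two imaginary terms. -/
theorem inner_map_map (C : Conjugation H) (x y : H) : inner ℂ (C x) (C y) = inner ℂ y x := by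
  have h1 : ∀ z : H, C x + C z = C (x + z) := fun z => (map_add C.toFun x z).symm
  have h2 : ∀ z : H, C x - C z = C (x - z) := fun z => (map_sub C.toFun x z).symm
  have h3 : Complex.I • C y = C (-(Complex.I • y)) := by
    rw [map_neg, C.toFun.map_smulₛₗ]
    simp
  have h4 : x - -(Complex.I • y) = x + Complex.I • y := by abel
  have h5 : x + -(Complex.I • y) = x - Complex.I • y := by abel
  rw [← inner_conj_symm y x, inner_eq_sum_norm_sq_div_four, inner_eq_sum_norm_sq_div_four]
  change _ = conj (((‖x + y‖ : ℂ) ^ 2 - (‖x - y‖ : ℂ) ^ 2 + ((‖x - Complex.I • y‖ : ℂ) ^ 2 -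
    (‖x + Complex.I • y‖ : ℂ) ^ 2) * Complex.I) / 4)
  change ((‖C x + C y‖ : ℂ) ^ 2 - (‖C x - C y‖ : ℂ) ^ 2 + ((‖C x - Complex.I • C y‖ : ℂ) ^ 2 -
    (‖C x + Complex.I • C y‖ : ℂ) ^ 2) * Complex.I) / 4 = _
  rw [h3, h1, h2, h1, h2, h4, h5]
  simp only [C.norm_map]
  simp only [map_div₀, map_add, map_sub, map_mul, map_pow, Complex.conj_ofReal, Complex.conj_I,
    map_ofNat]
  ring

theorem inner_map_left (C : Conjugation H) (x y : H) : inner ℂ (C x) y = inner ℂ (C y) x := by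
  have h := C.inner_map_map x (C y)
  rwa [C.involutive] at h

theorem continuous (C : Conjugation H) : Continuous C :=
  AddMonoidHomClass.continuous_of_bound C.toFun 1 fun x => by rw [C.norm_map, one_mul]

theorem mem_graph_sandwich (C : Conjugation H) (T : H →ₗ.[ℂ] H) {x y : H} :
    (x, y) ∈ (C.sandwich T).graph ↔ (C x, C y) ∈ T.graph := by
  constructor
  · intro h
    obtain ⟨h1, h2⟩ := (LinearPMap.mem_graph_iff _).1 h
    have h3 : C x ∈ T.domain := by
      have := LinearPMap.mem_domain_of_mem_graph h
      exact this
    have h4 : y = C (T ⟨C x, h3⟩) := by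
      have := LinearPMap.mem_graph (C.sandwich T) ⟨x, h3⟩
      exact (C.sandwich T).mem_graph_snd_inj h this rfl
    rw [h4, C.involutive]
    exact mem_graph_of_mem_domain h3
  · intro h
    have h3 : C x ∈ T.domain := LinearPMap.mem_domain_of_mem_graph h
    have h4 : T ⟨C x, h3⟩ = C y := T.mem_graph_snd_inj (mem_graph_of_mem_domain h3) h rfl
    have h5 := LinearPMap.mem_graph (C.sandwich T) ⟨x, h3⟩
    have h6 : C.sandwich T ⟨x, h3⟩ = y := by
      change C (T ⟨C x, h3⟩) = y
      rw [h4, C.involutive]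
    rwa [h6] at h5

end Conjugation

variable [CompleteSpace H] {C : Conjugation H} {T : H →ₗ.[ℂ] H}

theorem IsCSelfadjoint.mem_graph_iff (h : IsCSelfadjoint C T) {x y : H} :
    (x, y) ∈ T.graph ↔ (C x, C y) ∈ T.adjoint.graph := by
  conv_lhs => rw [h.2]
  exact C.mem_graph_sandwich _

/-- The graph is the preimage of the closed graph of `T.adjoint` under the continuous map `(C, C)`.
-/
theorem IsCSelfadjoint.isClosed (h : IsCSelfadjoint C T) : T.IsClosed := by
  have h1 : (T.graph : Set (H × H)) = (fun p : H × H => (C p.1, C p.2)) ⁻¹' T.adjoint.graph := by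
    ext ⟨x, y⟩
    exact h.mem_graph_iff
  rw [LinearPMap.IsClosed, h1]
  exact (LinearPMap.adjoint_isClosed h.1).preimage
    ((C.continuous.comp continuous_fst).prodMk (C.continuous.comp continuous_snd))

theorem IsCSelfadjoint.inner_eq (h : IsCSelfadjoint C T) {x v y w : H} (hx : (x, v) ∈ T.graph)
    (hy : (y, w) ∈ T.graph) : inner ℂ (C x) w = inner ℂ (C v) y := by
  rw [h.mem_graph_iff, LinearPMap.adjoint_graph_eq_graph_adjoint h.1,
    Submodule.mem_adjoint_iff] at hx
  have h1 := sub_eq_zero.1 (hx y w hy)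
  simp only at h1
  rw [← inner_conj_symm, h1, inner_conj_symm]

variable {T : ℝ → H →ₗ.[ℂ] H} {ω : ℝ} {l : ℂ} {x y : H}

/-- Laplace transforms of families of `C`-selfadjoint operators are `C`-symmetric. -/
theorem inner_conj_laplaceTransform (hT : ∀ t, 0 ≤ t → IsCSelfadjoint C (T t))
    (hx : x ∈ sigmaSet T ω) (hy : y ∈ sigmaSet T ω) (hl : ω < l.re) :
    inner ℂ (C (laplaceTransform T l x)) y = inner ℂ (C x) (laplaceTransform T l y) := by
  have hi : ∀ {z}, z ∈ sigmaSet T ω →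
      IntegrableOn (fun t : ℝ => Complex.exp (-l * t) • orbit T z t) (Ioi 0) := fun hz => by
    simpa only [add_zero] using integrableOn_exp_smul_orbit hz hl le_rfl
  -- Symmetry of the form `⟨C x, y⟩` puts both integrals in the linear slot, so the factor `e^{-λt}`
  -- comes out unconjugated on both sides.
  rw [C.inner_map_left, laplaceTransform, laplaceTransform, ← integral_inner (hi hx),
    ← integral_inner (hi hy)]
  refine setIntegral_congr_fun measurableSet_Ioi fun t ht => ?_
  have ht := ht.out.le
  simp only [inner_smul_right]
  rw [(hT t ht).inner_eq ((mem_semigroupVectors_iff.1 hx.1).1 t ht)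
    ((mem_semigroupVectors_iff.1 hy.1).1 t ht), C.inner_map_left y]

end Conj

/-! ### The differential expression of the generator -/

/-- Evaluation at a point as a continuous functional on the Fock space. -/
def Fock.evalCLM (z : ℂ) : Fock →L[ℂ] ℂ :=
  LinearMap.mkContinuous ⟨⟨fun f => f z, fun _ _ => rfl⟩, fun _ _ => rfl⟩
    (Real.exp ((‖z‖ + 1) ^ 2)) fun f => f.norm_apply_le z

theorem Fock.evalCLM_apply (z : ℂ) (f : Fock) : Fock.evalCLM z f = f z := rfl

section Translation

variable {a E F : ℂ} {W : ℝ → Fock →ₗ.[ℂ] Fock}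

theorem apply_of_mem_graph {t : ℝ} (hW : W t ≤ wcMax (transCocycle a E F t) (transFlow E t))
    {f g : Fock} (h : (f, g) ∈ (W t).graph) (z : ℂ) :
    g z = transCocycle a E F t z * f (transFlow E t z) := by
  have h1 := LinearPMap.le_graph_of_le hW h
  have h2 := LinearPMap.mem_domain_of_mem_graph h1
  have h3 := LinearPMap.mem_graph_snd_inj _ h1 (mem_graph_of_mem_domain h2) rfl
  rw [h3]
  rfl

theorem orbit_apply (hW : ∀ t : ℝ, 0 ≤ t → W t ≤ wcMax (transCocycle a E F t) (transFlow E t))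
    {f : Fock} (hf : f ∈ semigroupVectors W) {t : ℝ} (ht : 0 ≤ t) (z : ℂ) :
    orbit W f t z = transCocycle a E F t z * f (transFlow E t z) :=
  apply_of_mem_graph (hW t ht) ((mem_semigroupVectors_iff.1 hf).1 t ht) z

theorem transCocycle_zero (a E F z : ℂ) : transCocycle a E F 0 z = 1 := by simp [transCocycle]

theorem transFlow_zero (E z : ℂ) : transFlow E 0 z = z := by simp [transFlow]

/-- The exponent of the cocycle has `t`-derivative `F + aE(z + Et)`: its quadratic term is exactly
what makes this depend on the moving point `ζ_t(z)` alone. -/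
theorem hasDerivAt_transCocycle_mul (a E F : ℂ) {f : ℂ → ℂ} (hf : Differentiable ℂ f) (z : ℂ)
    (t : ℝ) : HasDerivAt (fun t : ℝ => transCocycle a E F t z * f (transFlow E t z))
      (transCocycle a E F t z * ((F + a * E * transFlow E t z) * f (transFlow E t z) +
        E * deriv f (transFlow E t z))) t := by
  have h1 : HasDerivAt (fun s : ℂ => z + E * s) E t := by
    simpa using ((hasDerivAt_id (t : ℂ)).const_mul E).const_add z
  have h2 : HasDerivAt (fun s : ℂ => f (z + E * s)) (deriv f (z + E * t) * E) t :=
    HasDerivAt.comp (t : ℂ) (hf (z + E * t)).hasDerivAt h1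
  have h3 : HasDerivAt (fun s : ℂ => F * s + a * E ^ 2 * s ^ 2 / 2) (F + a * E ^ 2 * t) t := by
    have := ((hasDerivAt_id (t : ℂ)).const_mul F).add
      ((((hasDerivAt_id (t : ℂ)).pow 2).const_mul (a * E ^ 2)).div_const 2)
    refine this.congr_deriv ?_
    simp
    ring
  have h4 : HasDerivAt (fun s : ℂ => z * (a * E * s)) (z * (a * E)) t := by
    have := ((hasDerivAt_id (t : ℂ)).const_mul (a * E)).const_mul z
    simpa using this
  have h5 := ((h3.cexp.mul h4.cexp).mul h2).comp_ofReal
  refine h5.congr_deriv ?_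
  simp only [transCocycle, transFlow, Pi.mul_apply]
  ring

theorem integrableOn_exp_mul_cocycle
    (hW : ∀ t : ℝ, 0 ≤ t → W t ≤ wcMax (transCocycle a E F t) (transFlow E t)) {f : Fock} {ω : ℝ}
    (hf : f ∈ sigmaSet W ω) {l : ℂ} (hl : ω < l.re) (z : ℂ) : IntegrableOn (fun t : ℝ =>
      Complex.exp (-l * t) * (transCocycle a E F t z * f (transFlow E t z))) (Ioi 0) := by
  have h1 := (Fock.evalCLM z).integrable_comp (integrableOn_exp_smul_orbit hf hl le_rfl)
  refine IntegrableOn.congr_fun h1 (fun t ht => ?_) measurableSet_Ioi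
  simp only [add_zero, map_smul, smul_eq_mul, Fock.evalCLM_apply]
  rw [orbit_apply hW hf.1 ht.out.le]

theorem laplaceTransform_apply
    (hW : ∀ t : ℝ, 0 ≤ t → W t ≤ wcMax (transCocycle a E F t) (transFlow E t)) {f : Fock} {ω : ℝ}
    (hf : f ∈ sigmaSet W ω) {l : ℂ} (hl : ω < l.re) (z : ℂ) : laplaceTransform W l f z =
      ∫ t in Ioi (0 : ℝ),
        Complex.exp (-l * t) * (transCocycle a E F t z * f (transFlow E t z)) := by
  have h0 := integrableOn_exp_smul_orbit hf hl le_rfl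
  simp only [add_zero] at h0
  rw [← Fock.evalCLM_apply, laplaceTransform, ← ContinuousLinearMap.integral_comp_comm _ h0]
  refine setIntegral_congr_fun measurableSet_Ioi fun t ht => ?_
  simp only [map_smul, smul_eq_mul, Fock.evalCLM_apply]
  rw [orbit_apply hW hf.1 ht.out.le]

/-- A change of variable moves the shift `s` into the lower limit of the integral, ready for the
fundamental theorem of calculus. -/
theorem orbit_laplaceTransform_apply (hcl : ∀ t, 0 ≤ t → (W t).IsClosed)
    (hW : ∀ t : ℝ, 0 ≤ t → W t ≤ wcMax (transCocycle a E F t) (transFlow E t)) {f : Fock} {ω : ℝ}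
    (hf : f ∈ sigmaSet W ω) {l : ℂ} (hl : ω < l.re) (z : ℂ) {s : ℝ} (hs : 0 ≤ s) :
    orbit W (laplaceTransform W l f) s z = Complex.exp (l * s) *
      ∫ t in Ioi s, Complex.exp (-l * t) * (transCocycle a E F t z * f (transFlow E t z)) := by
  rw [orbit_laplaceTransform hcl hf hl hs, ← Fock.evalCLM_apply,
    ← ContinuousLinearMap.integral_comp_comm _ (integrableOn_exp_smul_orbit hf hl hs)]
  have h1 := (measurePreserving_add_right volume s).setIntegral_preimage_emb
    (measurableEmbedding_addRight s)
    (fun t : ℝ => Complex.exp (-l * t) * (transCocycle a E F t z * f (transFlow E t z))) (Ioi s)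
  rw [← h1, ← integral_const_mul, preimage_add_const_Ioi, sub_self]
  refine setIntegral_congr_fun measurableSet_Ioi fun t ht => ?_
  simp only [map_smul, smul_eq_mul, Fock.evalCLM_apply]
  rw [orbit_apply hW hf.1 (add_nonneg ht.out.le hs), ← mul_assoc, ← mul_assoc, ← mul_assoc,
    ← Complex.exp_add]
  congr 3
  push_cast
  ring

/-- The orbit of `x = J_λ f` at `z` is computed twice: as a weighted translate of `x`, and as
`e^{λs}` times a tail integral. Comparing derivatives at `s = 0` gives the equation. -/
theorem laplaceTransform_ode (hcl : ∀ t, 0 ≤ t → (W t).IsClosed)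
    (hW : ∀ t : ℝ, 0 ≤ t → W t ≤ wcMax (transCocycle a E F t) (transFlow E t)) {f : Fock} {ω : ℝ}
    (hf : f ∈ sigmaSet W ω) {l : ℂ} (hl : ω < l.re) (z : ℂ) :
    (l • laplaceTransform W l f - f) z = (F + a * E * z) * laplaceTransform W l f z +
      E * deriv (laplaceTransform W l f).toFun z := by
  set x := laplaceTransform W l f with hx
  set k : ℝ → ℂ := fun t =>
    Complex.exp (-l * t) * (transCocycle a E F t z * f (transFlow E t z)) with hk
  have hkc : Continuous k := by
    have h1 : Continuous fun t : ℝ => transCocycle a E F t z * f (transFlow E t z) :=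
      continuous_iff_continuousAt.2 fun t =>
        (hasDerivAt_transCocycle_mul a E F f.differentiable z t).continuousAt
    fun_prop
  have hki : IntegrableOn k (Ioi 0) := integrableOn_exp_mul_cocycle hW hf hl z
  have hk0 : k 0 = f z := by simp [hk, transCocycle_zero, transFlow_zero]
  have hx0 : x z = ∫ t in Ioi (0 : ℝ), k t := laplaceTransform_apply hW hf hl z
  have h1 : HasDerivAt (fun s : ℝ => Complex.exp (l * s)) l 0 := by
    have h2 : HasDerivAt (fun s : ℂ => Complex.exp (l * s)) l ((0 : ℝ) : ℂ) := by
      have := ((hasDerivAt_id ((0 : ℝ) : ℂ)).const_mul l).cexp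
      simpa using this
    exact h2.comp_ofReal
  have h3 : HasDerivAt (fun s : ℝ => x z - ∫ t in (0 : ℝ)..s, k t) (-k 0) 0 :=
    (intervalIntegral.integral_hasDerivAt_right (hkc.intervalIntegrable _ _)
      (hkc.stronglyMeasurableAtFilter _ _) hkc.continuousAt).const_sub _
  have h4 := h1.mul h3
  have h5 := hasDerivAt_transCocycle_mul a E F x.differentiable z 0
  have h6 : ∀ s ∈ Ici (0 : ℝ), transCocycle a E F s z * x (transFlow E s z) =
      Complex.exp (l * s) * (x z - ∫ t in (0 : ℝ)..s, k t) := by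
    intro s hs
    rw [← orbit_apply hW (laplaceTransform_mem_sigmaSet hcl hf hl).1 hs z,
      orbit_laplaceTransform_apply hcl hW hf hl z hs, hx0,
      ← intervalIntegral.integral_interval_add_Ioi hki (hki.mono_set (Ioi_subset_Ioi hs))]
    ring
  -- The two expressions agree only for `s ≥ 0`, hence one-sided derivatives.
  have h7 := (uniqueDiffOn_Ici (0 : ℝ) 0 self_mem_Ici).eq_deriv _ h5.hasDerivWithinAt
    (h4.hasDerivWithinAt.congr h6 (h6 0 self_mem_Ici))
  simp only [transCocycle_zero, transFlow_zero, hk0] at h7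
  rw [one_mul] at h7
  rw [h7, Fock.sub_apply, Fock.smul_apply]
  simp
  ring

/-- The integrand is an exact `t`-derivative. The boundary term at infinity vanishes since `Re λ >
ω` and evaluation at `z` is bounded; the one at `0` is `f z`. -/
theorem eq_laplaceTransform
    (hW : ∀ t : ℝ, 0 ≤ t → W t ≤ wcMax (transCocycle a E F t) (transFlow E t)) {f g : Fock} {ω : ℝ}
    (hf : f ∈ sigmaSet W ω) (hg : g ∈ sigmaSet W ω)
    (hfg : ∀ z, g z = (F + a * E * z) * f z + E * deriv f z) {l : ℂ} (hl : ω < l.re) :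
    f = laplaceTransform W l (l • f - g) := by
  have hy : l • f - g ∈ sigmaSet W ω :=
    (sigmaSubmodule W ω).sub_mem ((sigmaSubmodule W ω).smul_mem l hf) hg
  refine Fock.ext fun z => ?_
  rw [laplaceTransform_apply hW hy hl]
  have hd : ∀ t : ℝ, HasDerivAt
      (fun t : ℝ => -(Complex.exp (-l * t) * (transCocycle a E F t z * f (transFlow E t z))))
      (Complex.exp (-l * t) * (transCocycle a E F t z * (l • f - g) (transFlow E t z))) t := by
    intro t
    have h1 : HasDerivAt (fun s : ℝ => Complex.exp (-l * s)) (-l * Complex.exp (-l * t)) t := by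
      have h2 : HasDerivAt (fun s : ℂ => Complex.exp (-l * s)) (Complex.exp (-l * t) * -l)
          (t : ℂ) := by
        have := ((hasDerivAt_id (t : ℂ)).const_mul (-l)).cexp
        simpa using this
      exact h2.comp_ofReal.congr_deriv (mul_comm _ _)
    refine (h1.mul (hasDerivAt_transCocycle_mul a E F f.differentiable z t)).neg.congr_deriv ?_
    rw [Fock.sub_apply, Fock.smul_apply, hfg]
    ring
  have ht : Tendsto
      (fun t : ℝ => -(Complex.exp (-l * t) * (transCocycle a E F t z * f (transFlow E t z))))
      atTop (𝓝 0) := by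
    obtain ⟨M, hM, hfM⟩ := (mem_sigmaSet_iff.1 hf).2
    have h1 : Tendsto (fun t : ℝ => Real.exp ((‖z‖ + 1) ^ 2) * M * Real.exp (-((l.re - ω) * t)))
        atTop (𝓝 0) := by
      have h2 := Real.tendsto_exp_neg_atTop_nhds_zero.comp
        ((tendsto_id (α := ℝ)).const_mul_atTop (sub_pos.2 hl))
      simpa using h2.const_mul (Real.exp ((‖z‖ + 1) ^ 2) * M)
    refine squeeze_zero_norm' ?_ h1
    filter_upwards [eventually_ge_atTop 0] with t ht
    rw [norm_neg, norm_mul, norm_cexp_neg_mul, ← orbit_apply hW hf.1 ht]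
    calc Real.exp (-l.re * t) * ‖orbit W f t z‖
        ≤ Real.exp (-l.re * t) * (Real.exp ((‖z‖ + 1) ^ 2) * (M * Real.exp (ω * t))) := by
          gcongr
          exact (Fock.norm_apply_le _ z).trans (by gcongr; exact hfM t ht)
      _ = Real.exp ((‖z‖ + 1) ^ 2) * M * (Real.exp (-l.re * t) * Real.exp (ω * t)) := by ring
      _ = _ := by
          rw [← Real.exp_add]
          congr 2
          ring
  rw [integral_Ioi_of_hasDerivAt_of_tendsto' (fun t _ => hd t)
    (integrableOn_exp_mul_cocycle hW hy hl z) ht]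
  simp [transCocycle_zero, transFlow_zero]

end Translation

/-! ### The generator -/

/-- The union over `ω` of the sets `{f ∈ Σ_ω | (F + aEz) f + E f' ∈ Σ_ω}`, as a subspace. -/
def generatorDomain (a E F : ℂ) (W : ℝ → Fock →ₗ.[ℂ] Fock) : Submodule ℂ Fock where
  carrier := ⋃ ω : ℝ, {f | f ∈ sigmaSet W ω ∧
    ∃ g ∈ sigmaSet W ω, ∀ z : ℂ, g z = (F + a * E * z) * f z + E * deriv f z}
  zero_mem' := by
    refine mem_iUnion.2 ⟨0, (sigmaSubmodule W 0).zero_mem, 0, (sigmaSubmodule W 0).zero_mem,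
      fun z => ?_⟩
    change (0 : ℂ) = (F + a * E * z) * 0 + E * deriv (fun _ : ℂ => (0 : ℂ)) z
    simp
  add_mem' {f₁ f₂} h₁ h₂ := by
    obtain ⟨ω₁, h₁, g₁, hg₁, h₁'⟩ := mem_iUnion.1 h₁
    obtain ⟨ω₂, h₂, g₂, hg₂, h₂'⟩ := mem_iUnion.1 h₂
    have hl := sigmaSet_mono W (le_max_left ω₁ ω₂)
    have hr := sigmaSet_mono W (le_max_right ω₁ ω₂)
    refine mem_iUnion.2 ⟨max ω₁ ω₂, (sigmaSubmodule W _).add_mem (hl h₁) (hr h₂), g₁ + g₂,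
      (sigmaSubmodule W _).add_mem (hl hg₁) (hr hg₂), fun z => ?_⟩
    have hd : deriv (f₁ + f₂).toFun z = deriv f₁ z + deriv f₂ z :=
      deriv_fun_add (f₁.differentiable z) (f₂.differentiable z)
    rw [hd, Fock.add_apply, Fock.add_apply, h₁', h₂']
    ring
  smul_mem' r f h := by
    obtain ⟨ω, h, g, hg, h'⟩ := mem_iUnion.1 h
    refine mem_iUnion.2 ⟨ω, (sigmaSubmodule W _).smul_mem r h, r • g,
      (sigmaSubmodule W _).smul_mem r hg, fun z => ?_⟩
    have hd : deriv (r • f).toFun z = r * deriv f z := deriv_const_mul r (f.differentiable z)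
    rw [hd, Fock.smul_apply, Fock.smul_apply, h']
    ring

theorem mem_generatorDomain {a E F : ℂ} {W : ℝ → Fock →ₗ.[ℂ] Fock} {f : Fock} :
    f ∈ generatorDomain a E F W ↔ ∃ ω : ℝ, f ∈ sigmaSet W ω ∧
      ∃ g ∈ sigmaSet W ω, ∀ z : ℂ, g z = (F + a * E * z) * f z + E * deriv f z :=
  mem_iUnion

theorem memFock_of_mem_generatorDomain {a E F : ℂ} {W : ℝ → Fock →ₗ.[ℂ] Fock} {f : Fock}
    (hf : f ∈ generatorDomain a E F W) :
    MemFock fun z => (F + a * E * z) * f z + E * deriv f z := by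
  obtain ⟨ω, -, g, -, h⟩ := mem_generatorDomain.1 hf
  have := g.memFock
  rwa [show g.toFun = _ from funext h] at this

/-- The operator `f ↦ (F + aEz) f + E f'` on `generatorDomain`. -/
def transGenerator (a E F : ℂ) (W : ℝ → Fock →ₗ.[ℂ] Fock) : Fock →ₗ.[ℂ] Fock where
  domain := generatorDomain a E F W
  toFun :=
    { toFun := fun f => ⟨fun z => (F + a * E * z) * f.1 z + E * deriv f.1 z,
        memFock_of_mem_generatorDomain f.2⟩
      map_add' := fun f g => Fock.ext fun z => by
        have hd : deriv (f.1 + g.1).toFun z = deriv f.1 z + deriv g.1 z :=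
          deriv_fun_add (f.1.differentiable z) (g.1.differentiable z)
        change (F + a * E * z) * (f.1 z + g.1 z) + E * deriv (f.1 + g.1).toFun z =
          ((F + a * E * z) * f.1 z + E * deriv f.1 z) + ((F + a * E * z) * g.1 z + E * deriv g.1 z)
        rw [hd]
        ring
      map_smul' := fun r f => Fock.ext fun z => by
        have hd : deriv (r • f.1).toFun z = r * deriv f.1 z :=
          deriv_const_mul r (f.1.differentiable z)
        change (F + a * E * z) * (r * f.1 z) + E * deriv (r • f.1).toFun z =
          r * ((F + a * E * z) * f.1 z + E * deriv f.1 z)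
        rw [hd]
        ring }

theorem transGenerator_apply {a E F : ℂ} {W : ℝ → Fock →ₗ.[ℂ] Fock}
    (f : (transGenerator a E F W).domain) (z : ℂ) :
    transGenerator a E F W f z = (F + a * E * z) * (f : Fock) z + E * deriv (f : Fock) z := rfl

section Generator

variable {a b c E F : ℂ} {W : ℝ → Fock →ₗ.[ℂ] Fock}

theorem transGenerator_apply_mem_sigmaSet {f : Fock} {ω : ℝ}
    (h : ∃ g ∈ sigmaSet W ω, ∀ z : ℂ, g z = (F + a * E * z) * f z + E * deriv f z)
    (hf' : f ∈ generatorDomain a E F W) : transGenerator a E F W ⟨f, hf'⟩ ∈ sigmaSet W ω := by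
  obtain ⟨g, hg, hfg⟩ := h
  rwa [show transGenerator a E F W ⟨f, hf'⟩ = g from Fock.ext fun z => (hfg z).symm]

theorem isGenerator_transGenerator (hcl : ∀ t, 0 ≤ t → (W t).IsClosed)
    (hW : ∀ t : ℝ, 0 ≤ t → W t ≤ wcMax (transCocycle a E F t) (transFlow E t)) :
    IsGenerator W (transGenerator a E F W) := by
  ext ⟨f, g⟩
  constructor
  · intro h
    have hf := LinearPMap.mem_domain_of_mem_graph h
    have hg : g = transGenerator a E F W ⟨f, hf⟩ :=
      LinearPMap.mem_graph_snd_inj _ h (mem_graph_of_mem_domain hf) rfl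
    obtain ⟨ω, hω, hex⟩ := mem_generatorDomain.1 hf
    have hg' := transGenerator_apply_mem_sigmaSet hex hf
    rw [← hg] at hg'
    -- Any `λ` with `Re λ > ω` would do; then `y = λ f - g` is forced.
    refine ⟨ω, (ω + 1 : ℝ), ((ω + 1 : ℝ) : ℂ) • f - g, by simp,
      (sigmaSubmodule W ω).sub_mem ((sigmaSubmodule W ω).smul_mem _ hω) hg', ?_, ?_⟩
    · refine eq_laplaceTransform hW hω hg' (fun z => ?_) (by simp)
      rw [hg]
      rfl
    · simp
  · rintro ⟨ω, l, y, hl, hy, hf, hg⟩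
    simp only at hf hg
    subst hf hg
    have hx := laplaceTransform_mem_sigmaSet hcl hy hl
    have hode := laplaceTransform_ode hcl hW hy hl
    have hdom : laplaceTransform W l y ∈ generatorDomain a E F W :=
      mem_generatorDomain.2 ⟨ω, hx, _,
        (sigmaSubmodule W ω).sub_mem ((sigmaSubmodule W ω).smul_mem l hx) hy, hode⟩
    have := mem_graph_of_mem_domain (T := transGenerator a E F W) hdom
    rwa [show transGenerator a E F W ⟨_, hdom⟩ = l • laplaceTransform W l y - y from
      Fock.ext fun z => (hode z).symm] at this

/-- With a common `ω`, write `x = J_λ(λx - Qx)` and `y = J_λ(λy - Qy)`. Symmetry of `J_λ` yields `⟨C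
x, λy - Qy⟩ = ⟨C(λx - Qx), y⟩`, where the `λ` terms cancel: `C` conjugates `λ` and the left slot
conjugates it back. -/
theorem isCSymmetric_transGenerator {C : Conjugation Fock}
    (hsa : ∀ t : ℝ, 0 ≤ t → IsCSelfadjoint C (W t))
    (hW : ∀ t : ℝ, 0 ≤ t → W t ≤ wcMax (transCocycle a E F t) (transFlow E t)) :
    IsCSymmetric C (transGenerator a E F W) := by
  rintro ⟨x, hx⟩ ⟨y, hy⟩
  have hx' := hx
  have hy' := hy
  obtain ⟨ω₁, hx1, gx, hgx1, hgx⟩ := mem_generatorDomain.1 hx'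
  obtain ⟨ω₂, hy1, gy, hgy1, hgy⟩ := mem_generatorDomain.1 hy'
  set ω := max ω₁ ω₂
  replace hx1 := sigmaSet_mono W (le_max_left ω₁ ω₂) hx1
  replace hgx1 := sigmaSet_mono W (le_max_left ω₁ ω₂) hgx1
  replace hy1 := sigmaSet_mono W (le_max_right ω₁ ω₂) hy1
  replace hgy1 := sigmaSet_mono W (le_max_right ω₁ ω₂) hgy1
  have hQx : transGenerator a E F W ⟨x, hx⟩ = gx := Fock.ext fun z => (hgx z).symm
  have hQy : transGenerator a E F W ⟨y, hy⟩ = gy := Fock.ext fun z => (hgy z).symm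
  rw [hQx, hQy]
  set l : ℂ := ((ω + 1 : ℝ) : ℂ)
  have hl : ω < l.re := by simp [l]
  have h := inner_conj_laplaceTransform hsa
    ((sigmaSubmodule W ω).sub_mem ((sigmaSubmodule W ω).smul_mem l hx1) hgx1)
    ((sigmaSubmodule W ω).sub_mem ((sigmaSubmodule W ω).smul_mem l hy1) hgy1) hl
  rw [← eq_laplaceTransform hW hx1 hgx1 hgx hl, ← eq_laplaceTransform hW hy1 hgy1 hgy hl,
    show C (l • x - gx) = conj l • C x - C gx by
      rw [← C.toFun.map_smulₛₗ]
      exact map_sub C.toFun _ _] at h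
  rw [inner_sub_right, inner_sub_left, inner_smul_left, inner_smul_right, Complex.conj_conj] at h
  exact sub_right_inj.1 h

/-! ### Failure of complex selfadjointness -/

/-- The orbit of the constant function grows like `exp (κ t² / 2)`. -/
theorem not_exponentially_bounded_orbit_one (ha : ‖a‖ = 1)
    (hE : 0 < (a * E ^ 2 + (‖E‖ : ℂ) ^ 2).re)
    (hW : ∀ t : ℝ, 0 ≤ t → W t ≤ wcMax (transCocycle a E F t) (transFlow E t)) {v : ℝ → Fock}
    (hv : ∀ t, 0 ≤ t → (Fock.expFun 0, v t) ∈ (W t).graph) {M ω : ℝ}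
    (hM : ∀ t, 0 ≤ t → ‖v t‖ ≤ M * Real.exp (ω * t)) : False := by
  set κ := (a * E ^ 2 + (‖E‖ : ℂ) ^ 2).re with hκ
  have hnorm : ∀ t, 0 ≤ t → ‖v t‖ ^ 2 = Real.exp (2 * F.re * t + κ * t ^ 2) := by
    intro t ht
    -- The orbit of `1` runs through multiples of reproducing kernels, whose norms are known
    -- exactly.
    have h1 : v t = Complex.exp (F * t + a * E ^ 2 * t ^ 2 / 2) • Fock.expFun (a * E * t) := by
      refine Fock.ext fun z => ?_
      rw [apply_of_mem_graph (hW t ht) (hv t ht) z, Fock.smul_apply, Fock.expFun_apply,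
        Fock.expFun_apply, transCocycle, zero_mul, Complex.exp_zero, mul_one, mul_comm z]
    have h2 : (F * t + a * E ^ 2 * t ^ 2 / 2).re = F.re * t + (a * E ^ 2).re * t ^ 2 / 2 := by
      have : F * t + a * E ^ 2 * t ^ 2 / 2 =
          F * (t : ℝ) + a * E ^ 2 * ((t ^ 2 / 2 : ℝ) : ℂ) := by
        push_cast
        ring
      rw [this, Complex.add_re, Complex.re_mul_ofReal, Complex.re_mul_ofReal]
      ring
    have h3 : κ = (a * E ^ 2).re + ‖E‖ ^ 2 := by
      rw [hκ, Complex.add_re, ← Complex.ofReal_pow, Complex.ofReal_re]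
    rw [h1, norm_smul, mul_pow, Fock.norm_expFun_sq, Complex.norm_exp, h2, h3, norm_mul, norm_mul,
      ha, one_mul, Complex.norm_real, mul_pow, Real.norm_eq_abs, sq_abs, ← Real.exp_nat_mul,
      ← Real.exp_add]
    congr 1
    push_cast
    ring
  set p := 2 * (F.re - ω) with hp
  -- Chosen so that `t ≥ 1` and `p + κt ≥ M²`; then the exponent `t(p + κt)` is at least `M²`, and
  -- `exp x ≥ x + 1` contradicts the bound `M²`.
  set t := (|p| + M ^ 2 + 1) / κ + 1 with ht
  have ht1 : 1 ≤ t := by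
    have : 0 ≤ (|p| + M ^ 2 + 1) / κ := by positivity
    linarith
  have ht0 : 0 ≤ t := by linarith
  have h4 : Real.exp (2 * F.re * t + κ * t ^ 2) ≤ M ^ 2 * Real.exp (2 * ω * t) := by
    rw [← hnorm t ht0]
    refine (pow_le_pow_left₀ (norm_nonneg _) (hM t ht0) 2).trans_eq ?_
    rw [mul_pow, ← Real.exp_nat_mul]
    congr 2
    push_cast
    ring
  have h5 : Real.exp (p * t + κ * t ^ 2) ≤ M ^ 2 := by
    rw [show p * t + κ * t ^ 2 = 2 * F.re * t + κ * t ^ 2 - 2 * ω * t by rw [hp]; ring,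
      Real.exp_sub, div_le_iff₀ (Real.exp_pos _)]
    exact h4
  have h6 := Real.add_one_le_exp (p * t + κ * t ^ 2)
  have h7 : κ * t = |p| + M ^ 2 + 1 + κ := by
    rw [ht]
    field_simp
  have h8 : M ^ 2 ≤ p + κ * t := by
    have := neg_abs_le p
    linarith
  have h9 : p * t + κ * t ^ 2 = t * (p + κ * t) := by ring
  nlinarith [sq_nonneg M]

theorem hasDerivAt_wcConj (habc : IsConjugationTriple a b c) (f : Fock) :
    HasDerivAt (wcConj a b c habc f : Fock).toFun
      (c * (b * conj (f (conj b)) + a * conj (deriv f (conj b)))) 0 := by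
  have h1 : HasDerivAt (fun z => conj (f (conj z))) (conj (deriv f (conj b))) (a * 0 + b) := by
    have := (f.differentiable (conj b)).hasDerivAt.conj_conj
    simpa [Function.comp_def] using this
  have h2 : HasDerivAt (fun z : ℂ => a * z + b) a 0 := by
    simpa using ((hasDerivAt_id (0 : ℂ)).const_mul a).add_const b
  have h3 : HasDerivAt (fun z : ℂ => c * Complex.exp (b * z)) (c * b) 0 := by
    simpa using ((hasDerivAt_id (0 : ℂ)).const_mul b).cexp.const_mul c
  have h4 := h3.mul (HasDerivAt.comp (0 : ℂ) h1 h2)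
  refine h4.congr_deriv ?_
  simp
  ring

/-- The image of the constant function under the adjoint of the generator, up to conjugation. -/
theorem inner_wcConj_transGenerator (habc : IsConjugationTriple a b c)
    (u : (transGenerator a E F W).domain) :
    inner ℂ (wcConj a b c habc (F • Fock.expFun 0 + (a * E) • Fock.coord)) (u : Fock) =
      inner ℂ (wcConj a b c habc (Fock.expFun 0)) (transGenerator a E F W u) := by
  set C := wcConj a b c habc
  have haa : a * conj a = 1 := by rw [Complex.mul_conj', habc.norm_a]; simp
  have hC0 : ∀ f : Fock, (C f : Fock) 0 = c * conj (f (conj b)) := by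
    intro f
    change c * Complex.exp (b * 0) * conj (f (conj (a * 0 + b))) = _
    simp
  -- Both sides become values of `u` and `u'` at `conj b`; `|a| = 1` then matches the derivative
  -- terms.
  rw [C.inner_map_left (_ + _), C.inner_map_left (Fock.expFun 0), inner_add_right, inner_smul_right, inner_smul_right,
    ← inner_conj_symm, ← inner_conj_symm (C u) Fock.coord,
    ← inner_conj_symm (C (transGenerator a E F W u)), Fock.inner_expFun, Fock.inner_coord,
    Fock.inner_expFun, map_zero, hC0, hC0, (hasDerivAt_wcConj habc u.1).deriv,
    transGenerator_apply]
  simp only [map_add, map_mul, Complex.conj_conj]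
  linear_combination (E * conj c * deriv u.1 (conj b)) * haa

/-- Equality with `C Q* C` would put the constant `1` into the domain of `Q`, hence into some `Σ_ω`,
against the Gaussian growth of its orbit. -/
theorem not_isCSelfadjoint_transGenerator (habc : IsConjugationTriple a b c)
    (hE : 0 < (a * E ^ 2 + (‖E‖ : ℂ) ^ 2).re)
    (hW : ∀ t : ℝ, 0 ≤ t → W t ≤ wcMax (transCocycle a E F t) (transFlow E t)) :
    ¬ IsCSelfadjoint (wcConj a b c habc) (transGenerator a E F W) := by
  rintro ⟨-, h⟩
  have h1 : Fock.expFun 0 ∈ (transGenerator a E F W).domain := by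
    rw [h]
    exact LinearPMap.mem_adjoint_domain_of_exists _ ⟨_, inner_wcConj_transGenerator habc⟩
  obtain ⟨ω, h2, -⟩ := mem_generatorDomain.1 h1
  obtain ⟨h3, M, -, hM⟩ := mem_sigmaSet_iff.1 h2
  exact not_exponentially_bounded_orbit_one habc.norm_a hE hW (mem_semigroupVectors_iff.1 h3).1 hM

/-- The witness is `C 1`: it is a first coordinate of the adjoint graph, but a Laplace transform for
the adjoint family would have an exponentially bounded orbit, and `W(t) = C W(t)* C` would transfer
that bound to the orbit of `1`. Taking the adjoint of the graph avoids any need for `Q` to be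
densely defined. -/
theorem adjoint_graph_transGenerator_ne {C : Conjugation Fock} (ha : ‖a‖ = 1)
    (hE : 0 < (a * E ^ 2 + (‖E‖ : ℂ) ^ 2).re)
    (hW : ∀ t : ℝ, 0 ≤ t → W t ≤ wcMax (transCocycle a E F t) (transFlow E t))
    (hsa : ∀ t : ℝ, 0 ≤ t → IsCSelfadjoint C (W t)) {w : Fock}
    (hw : ∀ u : (transGenerator a E F W).domain,
      inner ℂ w (u : Fock) = inner ℂ (C (Fock.expFun 0)) (transGenerator a E F W u)) :
    ((transGenerator a E F W).graph.adjoint : Set (Fock × Fock)) ≠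
      generatorGraph fun t => (W t).adjoint := by
  intro h
  have h1 : (C (Fock.expFun 0), w) ∈ (transGenerator a E F W).graph.adjoint := by
    rw [Submodule.mem_adjoint_iff]
    intro u v huv
    have hu := LinearPMap.mem_domain_of_mem_graph huv
    have hv : v = transGenerator a E F W ⟨u, hu⟩ :=
      LinearPMap.mem_graph_snd_inj _ huv (mem_graph_of_mem_domain hu) rfl
    have h2 := hw ⟨u, hu⟩
    rw [← hv] at h2
    rw [sub_eq_zero, ← inner_conj_symm, ← h2, inner_conj_symm]
  rw [← SetLike.mem_coe, h] at h1
  obtain ⟨ω, l, y, hl, hy, h2, _⟩ := h1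
  have hcl : ∀ t, 0 ≤ t → ((fun t => (W t).adjoint) t).IsClosed := fun t ht =>
    LinearPMap.adjoint_isClosed (hsa t ht).1
  have h3 : C (Fock.expFun 0) ∈ sigmaSet (fun t => (W t).adjoint) ω := by
    rw [show C (Fock.expFun 0) = _ from h2]
    exact laplaceTransform_mem_sigmaSet hcl hy hl
  obtain ⟨h4, M, -, hM⟩ := mem_sigmaSet_iff.1 h3
  have h5 := (mem_semigroupVectors_iff.1 h4).1
  refine not_exponentially_bounded_orbit_one ha hE hW
    (v := fun t => C (orbit (fun t => (W t).adjoint) (C (Fock.expFun 0)) t)) (fun t ht => ?_)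
    (M := M) (ω := ω) fun t ht => ?_
  · rw [(hsa t ht).mem_graph_iff, C.involutive]
    exact h5 t ht
  · rw [C.norm_map]
    exact hM t ht

/-! ### The point spectrum -/

/-- A positive function which does not decrease along the integer multiples of a nonzero
translation is not integrable. -/
theorem not_integrable_of_le_translate {h : ℂ → ℝ} (hpos : ∀ z, 0 < h z) {d : ℂ} (hd : d ≠ 0)
    (hle : ∀ z (n : ℕ), h z ≤ h (z + n * d)) : ¬ Integrable h := by
  intro hi
  have hpi : ∀ v : ℂ, Integrable fun z => h z * Real.exp (-‖z - v‖) := fun v => by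
    refine hi.mono (hi.aestronglyMeasurable.mul (by fun_prop)) (Eventually.of_forall fun z => ?_)
    rw [norm_mul]
    refine mul_le_of_le_one_right (norm_nonneg _) ?_
    rw [Real.norm_of_nonneg (Real.exp_pos _).le, Real.exp_le_one_iff]
    simp
  -- A window moving off to infinity sees less and less of an integrable function, yet by `hle` it
  -- sees at least the positive amount seen at `n = 0`.
  have h1 : Tendsto (fun n : ℕ => ∫ z, h z * Real.exp (-‖z - n * d‖)) atTop 
      (𝓝 (∫ _ : ℂ, (0 : ℝ))) := by
    refine tendsto_integral_of_dominated_convergence h (fun n => (hpi _).aestronglyMeasurable) hi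
      (fun n => Eventually.of_forall fun z => ?_) (Eventually.of_forall fun z => ?_)
    · rw [norm_mul, Real.norm_of_nonneg (hpos z).le, Real.norm_of_nonneg (Real.exp_pos _).le]
      refine mul_le_of_le_one_right (hpos z).le ?_
      rw [Real.exp_le_one_iff]
      simp
    · have h2 : Tendsto (fun n : ℕ => ‖z - n * d‖) atTop atTop := by
        have h3 : Tendsto (fun n : ℕ => (n : ℝ) * ‖d‖ - ‖z‖) atTop atTop :=
          tendsto_atTop_add_const_right _ _
            (tendsto_natCast_atTop_atTop.atTop_mul_const (norm_pos_iff.2 hd))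
        refine tendsto_atTop_mono (fun n => ?_) h3
        have h4 := norm_sub_norm_le ((n : ℂ) * d) z
        rw [norm_mul, Complex.norm_natCast, norm_sub_rev] at h4
        exact h4
      have h5 := (Real.tendsto_exp_neg_atTop_nhds_zero.comp h2).const_mul (h z)
      simpa using h5
  have h6 : ∀ n : ℕ, ∫ z, h z * Real.exp (-‖z - 0‖) ≤ ∫ z, h z * Real.exp (-‖z - n * d‖) := by
    intro n
    rw [← integral_add_right_eq_self (fun z => h z * Real.exp (-‖z - n * d‖)) (n * d)]
    refine integral_mono (hpi 0) ((hpi (n * d)).comp_add_right (n * d)) fun z => ?_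
    simp only [sub_zero, add_sub_cancel_right]
    exact mul_le_mul_of_nonneg_right (hle z n) (Real.exp_pos _).le
  have h7 := ge_of_tendsto' h1 h6
  rw [integral_zero] at h7
  refine h7.not_gt ?_
  rw [integral_pos_iff_support_of_nonneg (fun z => (mul_pos (hpos z) (Real.exp_pos _)).le) (hpi 0)]
  rw [show Function.support (fun z => h z * Real.exp (-‖z - 0‖)) = univ from
    eq_univ_of_forall fun z => (mul_pos (hpos z) (Real.exp_pos _)).ne']
  simp

/-- For `|a| = 1` the functions `exp (q z - a z² / 2)` do not lie in the Fock space. -/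
theorem not_memFock_exp_quadratic (ha : ‖a‖ = 1) {K : ℂ} (hK : K ≠ 0) (q : ℂ) :
    ¬ MemFock fun z => K * Complex.exp (q * z - a * z ^ 2 / 2) := by
  intro hmem
  have haa : a * conj a = 1 := by rw [Complex.mul_conj', ha]; simp
  -- Then `-a d² = 1 = |d|²`, so along `d` the quadratic exponent cancels the Gaussian; the sign of
  -- the root makes the linear term nonnegative.
  obtain ⟨d, hd2, hdq⟩ : ∃ d : ℂ, d ^ 2 = -conj a ∧ 0 ≤ (q * d).re := by
    obtain ⟨d, hd⟩ := IsAlgClosed.exists_pow_nat_eq (-conj a) (n := 2) (by norm_num)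
    rcases le_total 0 (q * d).re with h | h
    · exact ⟨d, hd, h⟩
    · exact ⟨-d, by rw [neg_sq, hd], by simpa using h⟩
  have hnd : ‖d‖ = 1 := by
    have h1 := congrArg norm hd2
    rw [norm_pow, norm_neg, RCLike.norm_conj, ha] at h1
    exact (pow_eq_one_iff_of_nonneg (norm_nonneg d) two_ne_zero).1 h1
  have hdd : d * conj d = 1 := by rw [Complex.mul_conj', hnd]; simp
  have had : a * d = -conj d := by
    linear_combination (a * d) * (-hdd) + conj d * a * hd2 - conj d * haa
  have hi := (memLp_fock_iff hmem.differentiable.continuous).1 hmem.memLp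
  have hexp : ∀ z : ℂ, Real.pi⁻¹ * Real.exp (-‖z‖ ^ 2) *
      ‖K * Complex.exp (q * z - a * z ^ 2 / 2)‖ ^ 2 =
      Real.pi⁻¹ * ‖K‖ ^ 2 * Real.exp (2 * q * z - a * z ^ 2 - z * conj z).re := by
    intro z
    rw [norm_mul, mul_pow, Complex.norm_exp, ← Real.exp_nat_mul]
    have h1 : (2 * q * z - a * z ^ 2 - z * conj z).re =
        -‖z‖ ^ 2 + (2 : ℕ) * (q * z - a * z ^ 2 / 2).re := by
      have h2 : 2 * q * z - a * z ^ 2 - z * conj z =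
          ((-‖z‖ ^ 2 : ℝ) : ℂ) + ((2 : ℝ) : ℂ) * (q * z - a * z ^ 2 / 2) := by
        rw [Complex.mul_conj']
        push_cast
        ring
      rw [h2, Complex.add_re, Complex.ofReal_re, Complex.re_ofReal_mul]
      norm_num
    rw [h1, Real.exp_add]
    ring
  refine not_integrable_of_le_translate (fun z => ?_) (d := d) ?_ (fun z n => ?_) hi
  · have := norm_pos_iff.2 hK
    have := Complex.exp_ne_zero (q * z - a * z ^ 2 / 2)
    have := norm_pos_iff.2 (mul_ne_zero hK this)
    positivity
  · rintro rfl
    simp at hnd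
  · rw [hexp, hexp]
    -- By `a d = -conj d`, translation by `n d` adds only `2n q d` and a purely imaginary term.
    have h1 : 2 * q * (z + n * d) - a * (z + n * d) ^ 2 -
        (z + n * d) * conj (z + n * d) = 2 * q * z - a * z ^ 2 - z * conj z +
          ((2 * n : ℝ) : ℂ) * (q * d) + n * (z * conj d - conj (z * conj d)) := by
      simp only [map_add, map_mul, Complex.conj_conj, map_natCast]
      push_cast
      linear_combination (-2 * z * n - n ^ 2 * d) * had
    have h2 : ((n : ℂ) * (z * conj d - conj (z * conj d))).re = 0 := by
      rw [Complex.sub_conj]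
      simp
    rw [h1, Complex.add_re, h2, Complex.add_re, Complex.re_ofReal_mul]
    gcongr
    have : (0 : ℝ) ≤ 2 * n * (q * d).re := by positivity
    linarith

/-- After division by `E`, the eigenvalue equation is `f' = (q - az) f`. The integrating factor
`exp(-(qz - az²/2))` makes `f` a nonzero multiple of a function outside the Fock space. -/
theorem pointSpectrum_transGenerator (ha : ‖a‖ = 1) (hE : E ≠ 0) :
    pointSpectrum (transGenerator a E F W) = ∅ := by
  refine eq_empty_of_forall_notMem ?_
  rintro η ⟨f, hf0, hf⟩
  have hode : ∀ z, (F + a * E * z) * f.1 z + E * deriv f.1 z = η * f.1 z := by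
    intro z
    have := congrArg (fun g : Fock => g z) hf
    simpa only [transGenerator_apply, Fock.smul_apply] using this
  set q := (η - F) / E with hq
  have hqd : ∀ z : ℂ, HasDerivAt (fun z : ℂ => Complex.exp (-(q * z - a * z ^ 2 / 2)))
      (Complex.exp (-(q * z - a * z ^ 2 / 2)) * (-(q - a * z))) z := by
    intro z
    have h1 := (((hasDerivAt_id z).const_mul q).sub
      ((((hasDerivAt_id z).pow 2).const_mul a).div_const 2)).neg.cexp
    refine h1.congr_deriv ?_
    simp
    ring
  have hd : ∀ z, HasDerivAt (fun z => f.1 z * Complex.exp (-(q * z - a * z ^ 2 / 2))) 0 z := by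
    intro z
    refine ((f.1.differentiable z).hasDerivAt.mul (hqd z)).congr_deriv ?_
    have h2 : deriv f.1 z = (q - a * z) * f.1 z := by
      have h3 : E * deriv f.1 z = E * ((q - a * z) * f.1 z) := by
        have h4 : E * q = η - F := by
          rw [hq]
          field_simp
        linear_combination hode z - f.1 z * h4
      exact mul_left_cancel₀ hE h3
    rw [h2]
    ring
  have hconst : ∀ z, f.1 z = f.1 0 * Complex.exp (q * z - a * z ^ 2 / 2) := by
    intro z
    have h1 := is_const_of_deriv_eq_zero (fun z => (hd z).differentiableAt)
      (fun z => (hd z).deriv) z 0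
    have h2 : Complex.exp (-(q * z - a * z ^ 2 / 2)) * Complex.exp (q * z - a * z ^ 2 / 2) = 1 := by
      rw [← Complex.exp_add]
      simp
    simp only [mul_zero, ne_eq, OfNat.ofNat_ne_zero, not_false_eq_true, zero_pow, zero_div,
      sub_zero, neg_zero, Complex.exp_zero, mul_one] at h1
    linear_combination Complex.exp (q * z - a * z ^ 2 / 2) * h1 - f.1 z * h2
  have hK : f.1 0 ≠ 0 := by
    intro h0
    refine hf0 (Fock.ext fun z => ?_)
    rw [hconst, h0, zero_mul]
    rfl
  refine not_memFock_exp_quadratic ha hK q ?_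
  have := f.1.memFock
  rwa [show f.1.toFun = _ from funext hconst] at this

end Generator

end

theorem mainTheorem2 (a b c E F : ℂ) (habc : IsConjugationTriple a b c) (hE : E ≠ 0)
    (W : ℝ → Fock →ₗ.[ℂ] Fock)
    (hW : ∀ t : ℝ, 0 ≤ t → W t ≤ wcMax (transCocycle a E F t) (transFlow E t))
    (hsemi : IsUnboundedC0Semigroup W)
    (hsa : ∀ t : ℝ, 0 ≤ t → IsCSelfadjoint (wcConj a b c habc) (W t)) :
    ∃ Q : Fock →ₗ.[ℂ] Fock, IsGenerator W Q ∧
      (Q.domain : Set Fock) = ⋃ ω : ℝ, {f | f ∈ sigmaSet W ω ∧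
        ∃ g ∈ sigmaSet W ω, ∀ z : ℂ, g z = (F + a * E * z) * f z + E * deriv f z} ∧
      (∀ (f : Q.domain) (z : ℂ),
        (Q f) z = (F + a * E * z) * (f : Fock) z + E * deriv (f : Fock) z) ∧
      IsCSymmetric (wcConj a b c habc) Q ∧
      (0 < (a * E ^ 2 + (‖E‖ : ℂ) ^ 2).re →
        ¬ IsCSelfadjoint (wcConj a b c habc) Q ∧
        (Q.graph.adjoint : Set (Fock × Fock)) ≠ generatorGraph fun t => (W t).adjoint) ∧
      pointSpectrum Q = ∅ := by
  have hcl : ∀ t, 0 ≤ t → (W t).IsClosed := fun t ht => (hsa t ht).isClosed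
  exact ⟨transGenerator a E F W, isGenerator_transGenerator hcl hW, rfl, transGenerator_apply,
    isCSymmetric_transGenerator hsa hW,
    fun h => ⟨not_isCSelfadjoint_transGenerator habc h hW,
      adjoint_graph_transGenerator_ne habc.norm_a h hW hsa
        (inner_wcConj_transGenerator habc)⟩,
    pointSpectrum_transGenerator habc.norm_a hE⟩
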